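/- Let $f:\mathbb{C}\to\mathbb{C}P^2$ (Fubini--Study metric of holomorphic sectional curvature $4$) be a conformally parametrized minimal Lagrangian immersion that is translationally equivariant: there is a one-parameter subgroup $R(t)$ of $SU(3)$ with $f(t+z)=R(t)f(z)$ for all $t\in\mathbb{R}$, $z\in\mathbb{C}$. Let $F:\mathbb{C}\to S^5\subset\mathbb{C}^3$ be a horizontal lift of $f$, $2e^{u}\,dz\,d\bar z$ with $e^u=F_z\cdot\overline{F_z}$ the induced metric, and write the cubic Hopf differential as $(F_{zz}\cdot\overline{F_{\bar z}})\,dz^3=-i\lambda^{-3}\psi\,dz^3$ with $|\lambda|=1$. Assume that $f$ is neither totally geodesic nor flat, i.e. $\psi\not\equiv0$ and $u$ is not constant. (Then $\psi$ is constant and $u$ depends only on $y=\operatorname{Im} z$.) Let $D=\mathbb{F}^{-1}\partial_x\mathbb{F}|_{z=0}$, where $\mathbb{F}$ is the matrix with columns $-i\lambda e^{-u/2}F_z,\ (i\lambda)^{-1}e^{-u/2}F_{\bar z},\ F$, and let $id_1,id_2,id_3$ be the eigenvalues of $D$, in any order and with multiplicity. Put $a_1=\max e^{u}$, $\delta=|\psi|^2/(2a_1^2)$,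 $a_2=\tfrac12\bigl(\delta+\sqrt{\delta^2+4a_1\delta}\bigr)$, $a_3=\tfrac12\bigl(-\delta+\sqrt{\delta^2+4a_1\delta}\bigr)$, and $$T=\frac{1}{\sqrt{2(a_1+a_3)}}\int_0^{\pi/2}\frac{d\alpha}{\sqrt{1-k^2\sin^2\alpha}},\qquad k^2=\frac{a_1-a_2}{a_1+a_3}$$ (so $2T$ is the smallest positive period of $y\mapsto u(iy)$). Let $\mathcal{L}(f)=\{\omega\in\mathbb{C}: f(z+\omega)=f(z)\text{ for all }z\in\mathbb{C}\}$ be the period lattice, and call $f$ an equivariant torus if $\mathcal{L}(f)$ contains two elements that are linearly independent over $\mathbb{R}$. Suppose that $\lambda^{-3}\psi$ is real. (1) If $f$ is an equivariant torus, then $f$ has a smallest positive real period $p_f$, $$\mathcal{L}(f)=p_f\mathbb{Z}+4Ti\,\mathbb{Z}\quad\text{or}\quad \mathcal{L}(f)=p_f\mathbb{Z}+\bigl(\tfrac12p_f+2Ti\bigr)\mathbb{Z},$$ and in both cases $d_2\ne0$ and $d_1/d_2$ is rational. (2) Conversely, if $d_1/d_2$ is rational, then $f$ is an equivariant torus, and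 $\mathcal{L}(f)$ is one of the two lattices in (1), where $p_f$ is the smallest positive real period of $f$. -/

import Mathlib

namespace MinLag

open scoped ContDiff Matrix
open Complex

/-- The Hermitian space `ℂ³`; the product `Z · W̄ = ∑ k, Z k * conj (W k)` is `Z ⬝ᵥ star W`. -/
abbrev C3 : Type := Fin 3 → ℂ

/-- The complex projective plane. -/
abbrev CP2 : Type := Projectivization ℂ C3

noncomputable section

/-- `∂F/∂z = (F_x - i F_y) / 2`, where `z = x + i y`. -/
def dz (F : ℂ → C3) (z : ℂ) : C3 :=
  (1 / 2 : ℂ) • (fderiv ℝ F z 1 - I • fderiv ℝ F z I)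

/-- `∂F/∂z̄ = (F_x + i F_y) / 2`, where `z = x + i y`. -/
def dzbar (F : ℂ → C3) (z : ℂ) : C3 :=
  (1 / 2 : ℂ) • (fderiv ℝ F z 1 + I • fderiv ℝ F z I)

/-- The conformal factor `e^u = F_z · conj F_z`; the induced metric is `2 e^u dz dz̄`. -/
def expU (F : ℂ → C3) (z : ℂ) : ℝ := (dz F z ⬝ᵥ star (dz F z)).re

/-- The function `u` in the induced metric `2 e^u dz dz̄`. -/
def metricU (F : ℂ → C3) (z : ℂ) : ℝ := Real.log (expU F z)

/-- The coefficient `F_zz · conj F_z̄` of the cubic Hopf differential. -/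
def hopf (F : ℂ → C3) (z : ℂ) : ℂ := dz (dz F) z ⬝ᵥ star (dzbar F z)

/-- The horizontal lift along `F` of the mean curvature vector of the conformal immersion `[F]`
into the complex projective plane with the Fubini-Study metric of holomorphic sectional
curvature 4.  For a horizontal unit lift `F`, the Levi-Civita derivative `∇_z̄ (∂ f / ∂ z)`
lifts to the component of `F_zz̄` orthogonal to the complex line through `F`, and half the trace
of the second fundamental form with respect to `2 e^u dz dz̄` is `e^{-u} ∇_z̄ (∂ f / ∂ z)`. -/
def meanCurvature (F : ℂ → C3) (z : ℂ) : C3 :=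
  ((expU F z : ℂ)⁻¹) •
    (dzbar (dz F) z - (dzbar (dz F) z ⬝ᵥ star (F z)) • F z)

/-- `F : ℂ → S⁵` is a smooth horizontal lift of the conformally parametrized minimal Lagrangian
immersion `f : ℂ → ℂP²`. -/
structure IsMinimalLagrangianLift (F : ℂ → C3) (f : ℂ → CP2) : Prop where
  smooth : ContDiff ℝ ∞ F
  unit : ∀ z, F z ⬝ᵥ star (F z) = 1
  lift : ∀ z, ∃ h : F z ≠ 0, f z = Projectivization.mk ℂ (F z) h
  horizontal_dz : ∀ z, dz F z ⬝ᵥ star (F z) = 0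
  horizontal_dzbar : ∀ z, dzbar F z ⬝ᵥ star (F z) = 0
  immersion : ∀ z, 0 < expU F z
  conformal : ∀ z, dz F z ⬝ᵥ star (dzbar F z) = 0
  conformal_dz : ∀ z, dz F z ⬝ᵥ star (dz F z) = (expU F z : ℂ)
  conformal_dzbar : ∀ z, dzbar F z ⬝ᵥ star (dzbar F z) = (expU F z : ℂ)
  minimal : ∀ z, meanCurvature F z = 0

/-- A special unitary matrix acts injectively on `ℂ³`. -/
theorem toLin_injective (A : Matrix.specialUnitaryGroup (Fin 3) ℂ) :
    Function.Injective (Matrix.toLin' (A : Matrix (Fin 3) (Fin 3) ℂ)) := by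
  have hdet : (A : Matrix (Fin 3) (Fin 3) ℂ).det = 1 :=
    (Matrix.mem_specialUnitaryGroup_iff.mp A.2).2
  have h : Function.Injective (A : Matrix (Fin 3) (Fin 3) ℂ).mulVec :=
    Matrix.mulVec_injective_of_isUnit ((Matrix.isUnit_iff_isUnit_det _).mpr (by rw [hdet]; exact isUnit_one))
  exact h

/-- The isometry of `ℂP²` induced by a matrix in `SU(3)`. -/
def projAct (A : Matrix.specialUnitaryGroup (Fin 3) ℂ) : CP2 → CP2 :=
  Projectivization.map (Matrix.toLin' (A : Matrix (Fin 3) (Fin 3) ℂ)) (toLin_injective A)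

/-- Equivariance of `f` with respect to all real translations and some one-parameter subgroup
of `SU(3)`. -/
def IsTranslationallyEquivariant (f : ℂ → CP2) : Prop :=
  ∃ R : ℝ → Matrix.specialUnitaryGroup (Fin 3) ℂ,
    Continuous R ∧ R 0 = 1 ∧ (∀ s t, R (s + t) = R s * R t) ∧
      ∀ (t : ℝ) (z : ℂ), f (t + z) = projAct (R t) (f z)

/-- The period lattice of `f`: all `w` with `f (z + w) = f z` for all `z`. -/
def periodLattice (f : ℂ → CP2) : AddSubgroup ℂ where
  carrier := {w | ∀ z, f (z + w) = f z}
  zero_mem' := by intro z; simp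
  add_mem' := by
    intro a b ha hb z
    rw [← add_assoc, hb (z + a), ha z]
  neg_mem' := by
    intro a ha z
    have h := ha (z + -a)
    rw [neg_add_cancel_right] at h
    exact h.symm

/-- `f` has two periods that are linearly independent over `ℝ`. -/
def IsEquivariantTorus (f : ℂ → CP2) : Prop :=
  ∃ w₁ ∈ periodLattice f, ∃ w₂ ∈ periodLattice f, LinearIndependent ℝ ![w₁, w₂]

/-- The gauged frame with columns `-iλ e^{-u/2} F_z`, `(iλ)⁻¹ e^{-u/2} F_z̄`, `F`. -/
def extendedFrame (F : ℂ → C3) (lam : ℂ) (z : ℂ) : Matrix (Fin 3) (Fin 3) ℂ :=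
  Matrix.of fun j =>
    ![-I * lam * (Real.exp (-(metricU F z) / 2) : ℂ) * dz F z j,
      (I * lam)⁻¹ * (Real.exp (-(metricU F z) / 2) : ℂ) * dzbar F z j,
      F z j]

/-- The generating matrix `D(λ) = 𝔽⁻¹ ∂ₓ 𝔽` at `z = 0`, where `𝔽` is the gauged frame.
It does not change when `𝔽` is multiplied from the left by a constant matrix, so `𝔽` need not be
normalized at `z = 0`. -/
def generator (F : ℂ → C3) (lam : ℂ) : Matrix (Fin 3) (Fin 3) ℂ :=
  (extendedFrame F lam 0)⁻¹ *
    Matrix.of fun i j => deriv (fun x : ℝ => extendedFrame F lam (x : ℂ) i j) 0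

/-- The complete elliptic integral of the first kind, as a function of the modulus `k`. -/
def ellipticK (k : ℝ) : ℝ :=
  ∫ α in (0 : ℝ)..(Real.pi / 2), 1 / √(1 - k ^ 2 * Real.sin α ^ 2)

/-- The maximum `a₁` of the conformal factor `e^u`. -/
def a₁ (F : ℂ → C3) : ℝ := ⨆ z, expU F z

/-- `β/2 - a₁ = |ψ|² / (2 a₁²)`, where `|ψ|` is the (constant) modulus of the Hopf coefficient. -/
def delta (F : ℂ → C3) : ℝ := ‖hopf F 0‖ ^ 2 / (2 * a₁ F ^ 2)

/-- The minimum `a₂` of the conformal factor `e^u`. -/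
def a₂ (F : ℂ → C3) : ℝ := (delta F + √(delta F ^ 2 + 4 * a₁ F * delta F)) / 2

/-- `-a₃` is the negative root of `w³ - (β/2) w² + |ψ|²/2`, the other roots being `a₁`, `a₂`. -/
def a₃ (F : ℂ → C3) : ℝ := (-delta F + √(delta F ^ 2 + 4 * a₁ F * delta F)) / 2

/-- `T = K(k) / r` with `k² = (a₁ - a₂) / (a₁ + a₃)` and `r = √(2 (a₁ + a₃))`; then `2T` is the
smallest positive period of the metric in the `y`-direction. -/
def halfPeriod (F : ℂ → C3) : ℝ :=
  ellipticK (√((a₁ F - a₂ F) / (a₁ F + a₃ F))) / √(2 * (a₁ F + a₃ F))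

end

end MinLag

/-!
Invariance of `e^u` under real translations makes it a function `v` of `y = Im z`, and holomorphy
of the Hopf coefficient, together with `λ⁻³ψ` being real, makes the latter a constant `-iρ`. The
Gauss equation integrates to `v'² / 4 + ρ² + 2v³ = βv²`, so `v` oscillates between the two positive
roots `a₁ > a₂` of `w³ - (β/2) w² + ρ²/2` with period `2T`.

The structure equations of the horizontal lift `F` are linear with coefficients depending only on
`y`, so `∂ₓ` preserves their solutions, on which it satisfies the characteristic equation
`X³ + βX - 2iρ = 0` of `D`. Hence `F` is a sum of three `iδ_j`-components, where `δ_j = ρ / w_j` and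
`w_j` runs over the roots `a₁`, `a₂`, `-a₃` of the cubic. Along the imaginary axis each component
solves a second order linear equation symmetric about the extrema of `v`, and the structure
equations force it to be odd about an extremum where `v = w_j` and even about the others.
Composing the reflections in a maximum and in the next minimum, translation by `2Ti` multiplies the
three components by `-1`, `-1`, `1`, while translation by a real `x` multiplies them by
`e^{iδ_j x}`. A period of `f` must multiply all three by the same factor, so everything reduces to
comparing phases: since `∑ δ_j = 0`, real periods exist if and only if `δ_i / δ_j` is rational,
`4Ti` is always a period, and `2Ti` never is.
-/

namespace MinLag

open scoped ContDiff Matrix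
open Complex

noncomputable section

section DirectionalDerivative

variable {V E : Type*} [NormedAddCommGroup V] [NormedSpace ℝ V] [NormedAddCommGroup E]
  [NormedSpace ℝ E]

/-- The derivative of `f` along the constant vector field `v`; the direction comes first so that
`dirDeriv v` is an operator on functions. -/
def dirDeriv (v : V) (f : V → E) (z : V) : E := fderiv ℝ f z v

theorem contDiff_dirDeriv {f : V → E} (hf : ContDiff ℝ ∞ f) (v : V) :
    ContDiff ℝ ∞ (dirDeriv v f) :=
  (hf.fderiv_right (m := ∞) (by simp)).clm_apply contDiff_const

theorem dirDeriv_comm {f : V → E} (hf : ContDiff ℝ ∞ f) (v w : V) :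
    dirDeriv v (dirDeriv w f) = dirDeriv w (dirDeriv v f) := by
  have hd : Differentiable ℝ (fderiv ℝ f) :=
    (hf.fderiv_right (m := ∞) (by simp)).differentiable (by simp)
  have second (a b z : V) : dirDeriv a (dirDeriv b f) z = fderiv ℝ (fderiv ℝ f) z a b :=
    congrArg (fun L : V →L[ℝ] E => L a)
      (((ContinuousLinearMap.apply ℝ E b).hasFDerivAt.comp z (hd z).hasFDerivAt).fderiv)
  funext z
  rw [second, second]
  have two_le : minSmoothness ℝ 2 ≤ ∞ := by
    simpa using WithTop.coe_le_coe.mpr (le_top (a := (2 : ℕ∞)))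
  exact hf.contDiffAt.isSymmSndFDerivAt two_le v w

theorem hasDerivAt_line {f : V → E} (hf : Differentiable ℝ f) (v z : V) (t : ℝ) :
    HasDerivAt (fun s : ℝ => f (z + s • v)) (dirDeriv v f (z + t • v)) t := by
  have hline : HasDerivAt (fun s : ℝ => z + s • v) v t := by
    simpa using ((hasDerivAt_id t).smul_const v).const_add z
  exact (hf (z + t • v)).hasFDerivAt.comp_hasDerivAt t hline

theorem dirDeriv_comp_add_right (f : V → E) (v w : V) :
    dirDeriv v (fun z => f (z + w)) = fun z => dirDeriv v f (z + w) :=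
  funext fun _ => congrArg (fun L : V →L[ℝ] E => L v) (fderiv_comp_add_right w)

theorem dirDeriv_add {f g : V → E} (hf : Differentiable ℝ f) (hg : Differentiable ℝ g) (v z : V) :
    dirDeriv v (fun z => f z + g z) z = dirDeriv v f z + dirDeriv v g z :=
  congrArg (fun L : V →L[ℝ] E => L v) (fderiv_fun_add (hf z) (hg z))

theorem dirDeriv_sub {f g : V → E} (hf : Differentiable ℝ f) (hg : Differentiable ℝ g) (v z : V) :
    dirDeriv v (fun z => f z - g z) z = dirDeriv v f z - dirDeriv v g z :=
  congrArg (fun L : V →L[ℝ] E => L v) (fderiv_fun_sub (hf z) (hg z))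

theorem dirDeriv_const_smul {𝕜 : Type*} [NormedField 𝕜] [NormedSpace 𝕜 E] [SMulCommClass ℝ 𝕜 E]
    {f : V → E} (hf : Differentiable ℝ f) (c : 𝕜) (v z : V) :
    dirDeriv v (fun z => c • f z) z = c • dirDeriv v f z :=
  congrArg (fun L : V →L[ℝ] E => L v) (fderiv_fun_const_smul (hf z) c)

theorem dirDeriv_clm_comp {E' : Type*} [NormedAddCommGroup E'] [NormedSpace ℝ E'] (L : E →L[ℝ] E')
    {f : V → E} (hf : Differentiable ℝ f) (v z : V) :
    dirDeriv v (fun z => L (f z)) z = L (dirDeriv v f z) :=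
  congrArg (fun A : V →L[ℝ] E' => A v) (L.hasFDerivAt.comp z (hf z).hasFDerivAt).fderiv

theorem eq_of_dirDeriv_eq_zero {f : V → E} (hf : Differentiable ℝ f)
    (h : ∀ v z, dirDeriv v f z = 0) (z w : V) : f z = f w :=
  is_const_of_fderiv_eq_zero hf (fun z => ContinuousLinearMap.ext fun v => h v z) z w

end DirectionalDerivative

section Wirtinger

variable {E : Type*} [NormedAddCommGroup E] [NormedSpace ℂ E]

/-- The Wirtinger derivative `∂f/∂z`, extending `dz` to maps into an arbitrary complex normed
space. -/
def wirtinger (f : ℂ → E) (z : ℂ) : E :=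
  (1 / 2 : ℂ) • (dirDeriv 1 f z - I • dirDeriv I f z)

/-- The conjugate Wirtinger derivative `∂f/∂z̄`, extending `dzbar` to maps into an arbitrary complex
normed space. -/
def wirtingerBar (f : ℂ → E) (z : ℂ) : E :=
  (1 / 2 : ℂ) • (dirDeriv 1 f z + I • dirDeriv I f z)

theorem wirtinger_eq_dz (F : ℂ → C3) : wirtinger F = dz F := rfl

theorem wirtingerBar_eq_dzbar (F : ℂ → C3) : wirtingerBar F = dzbar F := rfl

theorem dirDeriv_one_eq (f : ℂ → E) (z : ℂ) :
    dirDeriv 1 f z = wirtinger f z + wirtingerBar f z := by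
  simp only [wirtinger, wirtingerBar]
  module

theorem dirDeriv_I_eq (f : ℂ → E) (z : ℂ) :
    dirDeriv I f z = I • (wirtinger f z - wirtingerBar f z) := by
  simp only [wirtinger, wirtingerBar]
  match_scalars
  · linear_combination I_mul_I
  · ring

theorem contDiff_wirtinger {f : ℂ → E} (hf : ContDiff ℝ ∞ f) : ContDiff ℝ ∞ (wirtinger f) :=
  ((contDiff_dirDeriv hf 1).sub ((contDiff_dirDeriv hf I).const_smul I)).const_smul _

theorem contDiff_wirtingerBar {f : ℂ → E} (hf : ContDiff ℝ ∞ f) : ContDiff ℝ ∞ (wirtingerBar f) :=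
  ((contDiff_dirDeriv hf 1).add ((contDiff_dirDeriv hf I).const_smul I)).const_smul _

theorem wirtingerBar_wirtinger {f : ℂ → E} (hf : ContDiff ℝ ∞ f) (z : ℂ) :
    wirtingerBar (wirtinger f) z = wirtinger (wirtingerBar f) z := by
  have hd (v : ℂ) : HasFDerivAt (dirDeriv v f) (fderiv ℝ (dirDeriv v f) z) z :=
    ((contDiff_dirDeriv hf v).differentiable (by simp) z).hasFDerivAt
  have hdz : fderiv ℝ (wirtinger f) z =
      (1 / 2 : ℂ) • (fderiv ℝ (dirDeriv 1 f) z - I • fderiv ℝ (dirDeriv I f) z) :=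
    (((hd 1).sub ((hd I).const_smul I)).const_smul _).fderiv
  have hdzbar : fderiv ℝ (wirtingerBar f) z =
      (1 / 2 : ℂ) • (fderiv ℝ (dirDeriv 1 f) z + I • fderiv ℝ (dirDeriv I f) z) :=
    (((hd 1).add ((hd I).const_smul I)).const_smul _).fderiv
  have hcomm : fderiv ℝ (dirDeriv 1 f) z I = fderiv ℝ (dirDeriv I f) z 1 :=
    congrFun (dirDeriv_comm hf I 1) z
  simp only [wirtinger, wirtingerBar, dirDeriv] at hdz hdzbar hcomm ⊢
  simp only [hdz, hdzbar, hcomm, smul_apply, sub_apply, add_apply]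
  module

section SecondOrder

variable {f : ℂ → E} (hf : ContDiff ℝ ∞ f) (z : ℂ)
include hf

theorem dirDeriv_one_one : dirDeriv 1 (dirDeriv 1 f) z =
    wirtinger (wirtinger f) z + wirtingerBar (wirtingerBar f) z +
      (2 : ℂ) • wirtingerBar (wirtinger f) z := by
  rw [funext (dirDeriv_one_eq f),
    dirDeriv_add ((contDiff_wirtinger hf).differentiable (by simp))
      ((contDiff_wirtingerBar hf).differentiable (by simp)),
    dirDeriv_one_eq, dirDeriv_one_eq, wirtingerBar_wirtinger hf]
  module

theorem dirDeriv_one_I : dirDeriv 1 (dirDeriv I f) z =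
    I • (wirtinger (wirtinger f) z - wirtingerBar (wirtingerBar f) z) := by
  rw [dirDeriv_comm hf, funext (dirDeriv_one_eq f),
    dirDeriv_add ((contDiff_wirtinger hf).differentiable (by simp))
      ((contDiff_wirtingerBar hf).differentiable (by simp)),
    dirDeriv_I_eq, dirDeriv_I_eq, wirtingerBar_wirtinger hf]
  module

theorem dirDeriv_one_one_add_dirDeriv_I_I :
    dirDeriv 1 (dirDeriv 1 f) z + dirDeriv I (dirDeriv I f) z =
      (4 : ℂ) • wirtingerBar (wirtinger f) z := by
  have hA := (contDiff_wirtinger hf).differentiable (by simp)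
  have hB := (contDiff_wirtingerBar hf).differentiable (by simp)
  rw [dirDeriv_one_one hf, funext (dirDeriv_I_eq f),
    dirDeriv_const_smul (f := fun z => wirtinger f z - wirtingerBar f z) (hA.sub hB),
    dirDeriv_sub hA hB, dirDeriv_I_eq, dirDeriv_I_eq, wirtingerBar_wirtinger hf]
  simp only [smul_sub, smul_smul, I_mul_I]
  module

end SecondOrder

theorem wirtinger_const (c : E) (z : ℂ) : wirtinger (fun _ => c) z = 0 := by
  simp [wirtinger, dirDeriv]

theorem wirtingerBar_const (c : E) (z : ℂ) : wirtingerBar (fun _ => c) z = 0 := by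
  simp [wirtingerBar, dirDeriv]

theorem wirtinger_neg (f : ℂ → E) (z : ℂ) : wirtinger (fun z => -f z) z = -wirtinger f z := by
  simp only [wirtinger, dirDeriv, fderiv_fun_neg, neg_apply]
  module

theorem wirtinger_smul {a : ℂ → ℂ} {f : ℂ → E} (ha : Differentiable ℝ a) (hf : Differentiable ℝ f)
    (z : ℂ) :
    wirtinger (fun z => a z • f z) z = wirtinger a z • f z + a z • wirtinger f z := by
  simp only [wirtinger, dirDeriv, fderiv_fun_smul (ha z) (hf z)]
  simp only [add_apply, smul_apply, ContinuousLinearMap.smulRight_apply]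
  module

theorem wirtinger_comp_add_right (f : ℂ → E) (w z : ℂ) :
    wirtinger (fun z => f (z + w)) z = wirtinger f (z + w) := by
  simp only [wirtinger, dirDeriv_comp_add_right]

theorem wirtinger_clm_comp {E' : Type*} [NormedAddCommGroup E'] [NormedSpace ℂ E']
    (L : E →L[ℂ] E') {f : ℂ → E} (hf : Differentiable ℝ f) (z : ℂ) :
    wirtinger (fun z => L (f z)) z = L (wirtinger f z) := by
  have h (v : ℂ) : dirDeriv v (fun z => L (f z)) z = L (dirDeriv v f z) :=
    dirDeriv_clm_comp (L.restrictScalars ℝ) hf v z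
  simp only [wirtinger, h, map_smul, map_sub]

end Wirtinger

local notation "⟪" A ", " B "⟫" => A ⬝ᵥ star B

section Hermitian

variable {n : Type*} [Fintype n]

theorem dotProduct_star_mulVec_of_mem_unitaryGroup [DecidableEq n] {U : Matrix n n ℂ}
    (hU : U ∈ Matrix.unitaryGroup n ℂ) (A B : n → ℂ) : ⟪U *ᵥ A, U *ᵥ B⟫ = ⟪A, B⟫ := by
  rw [Matrix.star_mulVec, dotProduct_comm, Matrix.dotProduct_mulVec, Matrix.vecMul_vecMul,
    ← Matrix.star_eq_conjTranspose, Matrix.mem_unitaryGroup_iff'.mp hU, Matrix.vecMul_one,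
    dotProduct_comm]

theorem mul_conjTranspose_of_orthogonal [DecidableEq n] {X : Matrix n n ℂ}
    (horth : Pairwise fun i j => ⟪X i, X j⟫ = 0) :
    X * Xᴴ = Matrix.diagonal fun i => ⟪X i, X i⟫ := by
  ext i j
  rw [Matrix.diagonal_apply]
  split_ifs with h
  · exact h ▸ rfl
  · exact horth h

theorem isUnit_det_of_orthogonal [DecidableEq n] {X : Matrix n n ℂ}
    (horth : Pairwise fun i j => ⟪X i, X j⟫ = 0) (hne : ∀ i, ⟪X i, X i⟫ ≠ 0) : IsUnit X.det := by
  have hdet := congrArg Matrix.det (mul_conjTranspose_of_orthogonal horth)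
  rw [Matrix.det_mul, Matrix.det_diagonal] at hdet
  exact isUnit_iff_ne_zero.mpr
    (left_ne_zero_of_mul (hdet ▸ Finset.prod_ne_zero_iff.mpr fun i _ => hne i))

theorem sum_smul_of_orthogonal {X : Matrix n n ℂ}
    (horth : Pairwise fun i j => ⟪X i, X j⟫ = 0) (hne : ∀ i, ⟪X i, X i⟫ ≠ 0) (V : n → ℂ) :
    ∑ i, (⟪V, X i⟫ / ⟪X i, X i⟫) • X i = V := by
  classical
  set D : Matrix n n ℂ := Matrix.diagonal fun i => ⟪X i, X i⟫⁻¹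
  have hinv : X * (Xᴴ * D) = 1 := by
    rw [← Matrix.mul_assoc, mul_conjTranspose_of_orthogonal horth, Matrix.diagonal_mul_diagonal]
    simp [hne]
  calc ∑ i, (⟪V, X i⟫ / ⟪X i, X i⟫) • X i = ((V ᵥ* Xᴴ) ᵥ* D) ᵥ* X := by
        rw [Matrix.vecMul_eq_sum]
        refine Finset.sum_congr rfl fun i _ => ?_
        rw [Matrix.vecMul_diagonal, div_eq_mul_inv]
        rfl
    _ = V := by rw [Matrix.vecMul_vecMul, Matrix.vecMul_vecMul, ← Matrix.mul_assoc,
        mul_eq_one_comm.mp hinv, Matrix.vecMul_one]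

variable {W : Type*} [NormedAddCommGroup W] [NormedSpace ℝ W] {A B : W → n → ℂ}

theorem differentiable_dotProduct_star (hA : Differentiable ℝ A) (hB : Differentiable ℝ B) :
    Differentiable ℝ fun z => ⟪A z, B z⟫ :=
  Differentiable.fun_sum fun k _ => (differentiable_pi.mp hA k).mul (differentiable_pi.mp hB k).star

theorem dirDeriv_dotProduct_star (hA : Differentiable ℝ A) (hB : Differentiable ℝ B) (v z : W) :
    dirDeriv v (fun z => ⟪A z, B z⟫) z = ⟪dirDeriv v A z, B z⟫ + ⟪A z, dirDeriv v B z⟫ := by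
  have h : HasFDerivAt (fun z => ⟪A z, B z⟫) _ z := HasFDerivAt.fun_sum fun k _ =>
    (hasFDerivAt_pi'.mp (hA z).hasFDerivAt k).mul (hasFDerivAt_pi'.mp (hB z).hasFDerivAt k).star
  rw [dirDeriv, h.fderiv]
  simp [dirDeriv, dotProduct, Finset.sum_add_distrib, mul_comm, add_comm]

theorem wirtinger_dotProduct_star {A B : ℂ → n → ℂ} (hA : Differentiable ℝ A)
    (hB : Differentiable ℝ B) (z : ℂ) :
    wirtinger (fun z => ⟪A z, B z⟫) z = ⟪wirtinger A z, B z⟫ + ⟪A z, wirtingerBar B z⟫ := by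
  simp only [wirtinger, wirtingerBar, dirDeriv_dotProduct_star hA hB, smul_dotProduct,
    sub_dotProduct, star_smul, star_add, dotProduct_smul, dotProduct_add, smul_eq_mul]
  simp only [one_div, star_inv₀, star_ofNat, RCLike.star_def, conj_I]
  ring

theorem wirtingerBar_dotProduct_star {A B : ℂ → n → ℂ} (hA : Differentiable ℝ A)
    (hB : Differentiable ℝ B) (z : ℂ) :
    wirtingerBar (fun z => ⟪A z, B z⟫) z = ⟪wirtingerBar A z, B z⟫ + ⟪A z, wirtinger B z⟫ := by
  simp only [wirtinger, wirtingerBar, dirDeriv_dotProduct_star hA hB, smul_dotProduct,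
    add_dotProduct, star_smul, star_sub, dotProduct_smul, dotProduct_sub, smul_eq_mul]
  simp only [one_div, star_inv₀, star_ofNat, RCLike.star_def, conj_I]
  ring

theorem wirtinger_dotProduct_star_of_const {A B : ℂ → n → ℂ} (hA : Differentiable ℝ A)
    (hB : Differentiable ℝ B) {c : ℂ} (hAB : ∀ z, ⟪A z, B z⟫ = c) (z : ℂ) :
    ⟪wirtinger A z, B z⟫ = -⟪A z, wirtingerBar B z⟫ := by
  rw [eq_neg_iff_add_eq_zero, ← wirtinger_dotProduct_star hA hB, funext hAB, wirtinger_const]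

theorem wirtingerBar_dotProduct_star_of_const {A B : ℂ → n → ℂ} (hA : Differentiable ℝ A)
    (hB : Differentiable ℝ B) {c : ℂ} (hAB : ∀ z, ⟪A z, B z⟫ = c) (z : ℂ) :
    ⟪wirtingerBar A z, B z⟫ = -⟪A z, wirtinger B z⟫ := by
  rw [eq_neg_iff_add_eq_zero, ← wirtingerBar_dotProduct_star hA hB, funext hAB,
    wirtingerBar_const]

theorem exists_const_smul_of_horizontal {G H : W → n → ℂ} (hG : Differentiable ℝ G)
    (hH : Differentiable ℝ H) (hG₀ : ∀ z, G z ≠ 0) (hH₁ : ∀ z, ⟪H z, H z⟫ = 1)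
    (hdG : ∀ v z, ⟪dirDeriv v G z, G z⟫ = 0) (hdH : ∀ v z, ⟪dirDeriv v H z, H z⟫ = 0)
    (hGH : ∀ z, ∃ a : ℂ, G z = a • H z) : ∃ c : ℂ, ∀ z, G z = c • H z := by
  have coeff (z : W) : G z = ⟪G z, H z⟫ • H z := by
    obtain ⟨a, ha⟩ := hGH z
    rw [ha, smul_dotProduct, hH₁, smul_eq_mul, mul_one]
  have coeff_ne (z : W) : ⟪G z, H z⟫ ≠ 0 := fun h => hG₀ z (by rw [coeff z, h, zero_smul])
  have hconst (v z : W) : dirDeriv v (fun z => ⟪G z, H z⟫) z = 0 := by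
    have hleft : ⟪dirDeriv v G z, H z⟫ = 0 := by
      have := hdG v z
      rw [coeff z, star_smul, dotProduct_smul, smul_eq_mul] at this
      exact (mul_eq_zero.mp this).resolve_left (star_ne_zero.mpr (coeff_ne z))
    have hright : ⟪G z, dirDeriv v H z⟫ = 0 := by
      rw [coeff z, smul_dotProduct, Matrix.dotProduct_star (H z), hdH, star_zero, smul_zero]
    rw [dirDeriv_dotProduct_star hG hH, hleft, hright, add_zero]
  refine ⟨⟪G 0, H 0⟫, fun z => ?_⟩
  rw [eq_of_dirDeriv_eq_zero (differentiable_dotProduct_star hG hH) hconst 0 z, ← coeff]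

end Hermitian

section Congruence

theorem projAct_one (p : CP2) : projAct 1 p = p := by
  induction p using Projectivization.ind with
  | h v hv => simp [projAct, Projectivization.map_mk]

theorem expU_add_of_unitary {F : ℂ → C3} (hF : Differentiable ℝ F) {τ : ℂ}
    {U : Matrix (Fin 3) (Fin 3) ℂ} (hU : U ∈ Matrix.unitaryGroup (Fin 3) ℂ)
    (hτ : ∀ z, F (z + τ) = U *ᵥ F z) (z : ℂ) : expU F (z + τ) = expU F z := by
  have hdz : dz F (z + τ) = U *ᵥ dz F z := by
    rw [← wirtinger_eq_dz, ← wirtinger_comp_add_right, funext hτ]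
    exact wirtinger_clm_comp (Matrix.toLin' U).toContinuousLinearMap hF z
  rw [expU, hdz, dotProduct_star_mulVec_of_mem_unitaryGroup hU, expU]

namespace IsMinimalLagrangianLift

variable {F : ℂ → C3} {f : ℂ → CP2} (hF : IsMinimalLagrangianLift F f)
include hF

theorem differentiable : Differentiable ℝ F := hF.smooth.differentiable (by simp)

theorem ne_zero (z : ℂ) : F z ≠ 0 := (hF.lift z).choose

theorem horizontal (v z : ℂ) : ⟪dirDeriv v F z, F z⟫ = 0 := by
  have hone : ⟪dirDeriv 1 F z, F z⟫ = 0 := by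
    rw [dirDeriv_one_eq, add_dotProduct, wirtinger_eq_dz, wirtingerBar_eq_dzbar, hF.horizontal_dz,
      hF.horizontal_dzbar, add_zero]
  have hI : ⟪dirDeriv I F z, F z⟫ = 0 := by
    rw [dirDeriv_I_eq, smul_dotProduct, sub_dotProduct, wirtinger_eq_dz, wirtingerBar_eq_dzbar,
      hF.horizontal_dz, hF.horizontal_dzbar, sub_zero, smul_zero]
  have hv : dirDeriv v F z = v.re • dirDeriv 1 F z + v.im • dirDeriv I F z := by
    simp only [dirDeriv, ← map_smul, ← map_add]
    congr 1
    simp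
  rw [hv, add_dotProduct, smul_dotProduct, smul_dotProduct, hone, hI, smul_zero, smul_zero,
    add_zero]

theorem exists_phase {τ : ℂ} {U : Matrix.specialUnitaryGroup (Fin 3) ℂ}
    (hτ : ∀ z, f (z + τ) = projAct U (f z)) :
    ∃ c : ℂ, star c * c = 1 ∧ ∀ z, F (z + τ) = c • (U.1 *ᵥ F z) := by
  have hU : U.1 ∈ Matrix.unitaryGroup (Fin 3) ℂ := (Matrix.mem_specialUnitaryGroup_iff.mp U.2).1
  let L : C3 →L[ℝ] C3 := (Matrix.toLin' U.1).toContinuousLinearMap.restrictScalars ℝ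
  have hprop (z : ℂ) : ∃ a : ℂ, F (z + τ) = a • (U.1 *ᵥ F z) := by
    obtain ⟨h, hfτ⟩ := hF.lift (z + τ)
    obtain ⟨h', hf⟩ := hF.lift z
    have hmk := hτ z
    rw [hfτ, hf, projAct, Projectivization.map_mk, Projectivization.mk_eq_mk_iff'] at hmk
    exact hmk.imp fun a ha => ha.symm
  have hunit (z : ℂ) : ⟪U.1 *ᵥ F z, U.1 *ᵥ F z⟫ = 1 := by
    rw [dotProduct_star_mulVec_of_mem_unitaryGroup hU, hF.unit]
  obtain ⟨c, hc⟩ := exists_const_smul_of_horizontal (G := fun z => F (z + τ))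
    (H := fun z => U.1 *ᵥ F z) (hF.differentiable.comp (differentiable_id.add_const τ))
    (L.differentiable.comp hF.differentiable) (fun z => hF.ne_zero _) hunit
    (fun v z => by simpa only [dirDeriv_comp_add_right] using hF.horizontal v (z + τ))
    (fun v z => by
      rw [show dirDeriv v (fun z => U.1 *ᵥ F z) z = U.1 *ᵥ dirDeriv v F z from
          dirDeriv_clm_comp L hF.differentiable v z,
        dotProduct_star_mulVec_of_mem_unitaryGroup hU, hF.horizontal]) hprop
  refine ⟨c, ?_, hc⟩
  have hnorm := hF.unit (0 + τ)
  rw [hc, smul_dotProduct, star_smul, dotProduct_smul, hunit] at hnorm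
  simpa [mul_comm] using hnorm

theorem expU_add_of_congruent {τ : ℂ} {U : Matrix.specialUnitaryGroup (Fin 3) ℂ}
    (hτ : ∀ z, f (z + τ) = projAct U (f z)) (z : ℂ) : expU F (z + τ) = expU F z := by
  obtain ⟨c, hc, hFτ⟩ := hF.exists_phase hτ
  refine expU_add_of_unitary hF.differentiable (U := c • U.1) ?_
    (fun z => by rw [hFτ, Matrix.smul_mulVec]) z
  rw [Matrix.mem_unitaryGroup_iff', star_smul, smul_mul_smul_comm, hc, one_smul]
  exact Matrix.mem_unitaryGroup_iff'.mp (Matrix.mem_specialUnitaryGroup_iff.mp U.2).1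

theorem metricU_add_ofReal (hequiv : IsTranslationallyEquivariant f) (z : ℂ) (t : ℝ) :
    metricU F (z + t) = metricU F z := by
  obtain ⟨R, -, -, -, hR⟩ := hequiv
  rw [metricU, hF.expU_add_of_congruent (fun z => by rw [add_comm]; exact hR t z), metricU]

theorem mem_periodLattice_iff (τ : ℂ) :
    τ ∈ periodLattice f ↔ ∃ c : ℂ, ∀ z, F (z + τ) = c • F z := by
  constructor
  · intro hτ
    obtain ⟨c, -, hc⟩ := hF.exists_phase (U := 1) fun z => (hτ z).trans (projAct_one _).symm
    exact ⟨c, by simpa using hc⟩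
  · rintro ⟨c, hc⟩ z
    obtain ⟨h, hfτ⟩ := hF.lift (z + τ)
    obtain ⟨h', hf⟩ := hF.lift z
    rw [hfτ, hf, Projectivization.mk_eq_mk_iff']
    exact ⟨c, (hc z).symm⟩

theorem expU_add_of_mem_periodLattice {τ : ℂ} (hτ : τ ∈ periodLattice f) (z : ℂ) :
    expU F (z + τ) = expU F z :=
  hF.expU_add_of_congruent (U := 1) (fun z => (hτ z).trans (projAct_one _).symm) z

end IsMinimalLagrangianLift

end Congruence

section StructureEquations

/-- The conformal factor `e^u` as a complex-valued function, so that it has Wirtinger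
derivatives. -/
def cexpU (F : ℂ → C3) (z : ℂ) : ℂ := expU F z

namespace IsMinimalLagrangianLift

variable {F : ℂ → C3} {f : ℂ → CP2} (hF : IsMinimalLagrangianLift F f)
include hF

theorem contDiff_dz : ContDiff ℝ ∞ (dz F) := contDiff_wirtinger hF.smooth

theorem contDiff_dzbar : ContDiff ℝ ∞ (dzbar F) := contDiff_wirtingerBar hF.smooth

theorem differentiable_dz : Differentiable ℝ (dz F) := hF.contDiff_dz.differentiable (by simp)

theorem differentiable_dzbar : Differentiable ℝ (dzbar F) :=
  hF.contDiff_dzbar.differentiable (by simp)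

theorem differentiable_dz_dz : Differentiable ℝ (dz (dz F)) :=
  (contDiff_wirtinger hF.contDiff_dz).differentiable (by simp)

theorem cexpU_eq : cexpU F = fun z => ⟪dz F z, dz F z⟫ := (funext hF.conformal_dz).symm

theorem differentiable_cexpU : Differentiable ℝ (cexpU F) :=
  hF.cexpU_eq ▸ differentiable_dotProduct_star hF.differentiable_dz hF.differentiable_dz

theorem expU_ne_zero (z : ℂ) : (expU F z : ℂ) ≠ 0 := ofReal_ne_zero.mpr (hF.immersion z).ne'

theorem dotProduct_dzbar_dz (z : ℂ) : ⟪dzbar F z, dz F z⟫ = 0 := by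
  rw [Matrix.dotProduct_star, hF.conformal, star_zero]

theorem orthogonal_frame (z : ℂ) :
    Pairwise fun i j => ⟪![dz F z, dzbar F z, F z] i, ![dz F z, dzbar F z, F z] j⟫ = 0 := by
  have horth : ∀ {A B : C3}, ⟪A, B⟫ = 0 → ⟪B, A⟫ = 0 := fun h => by
    rw [Matrix.dotProduct_star, h, star_zero]
  intro i j hij
  fin_cases i <;> fin_cases j <;> first
    | exact absurd rfl hij
    | exact hF.conformal z
    | exact hF.horizontal_dz z
    | exact hF.horizontal_dzbar z
    | exact horth (hF.conformal z)
    | exact horth (hF.horizontal_dz z)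
    | exact horth (hF.horizontal_dzbar z)

theorem dotProduct_frame_ne_zero (z : ℂ) (i : Fin 3) :
    ⟪![dz F z, dzbar F z, F z] i, ![dz F z, dzbar F z, F z] i⟫ ≠ 0 := by
  have hw := hF.expU_ne_zero z
  fin_cases i
  · exact (hF.conformal_dz z).trans_ne hw
  · exact (hF.conformal_dzbar z).trans_ne hw
  · exact (hF.unit z).trans_ne one_ne_zero

theorem frame_expansion (z : ℂ) (V : C3) :
    (expU F z : ℂ) • V =
      ⟪V, dz F z⟫ • dz F z + ⟪V, dzbar F z⟫ • dzbar F z + ((expU F z : ℂ) * ⟪V, F z⟫) • F z := by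
  have hW := hF.expU_ne_zero z
  have h := sum_smul_of_orthogonal (hF.orthogonal_frame z) (hF.dotProduct_frame_ne_zero z) V
  simp only [Fin.sum_univ_three, Matrix.cons_val, hF.conformal_dz, hF.conformal_dzbar,
    hF.unit, div_one] at h
  nth_rewrite 1 [← h]
  simp only [smul_add, smul_smul, mul_div_cancel₀ _ hW]

theorem dzbar_dz_eq_dz_dzbar (z : ℂ) : dzbar (dz F) z = dz (dzbar F) z :=
  wirtingerBar_wirtinger hF.smooth z

theorem dzbar_dz (z : ℂ) : dzbar (dz F) z = -((expU F z : ℂ) • F z) := by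
  have hmin := hF.minimal z
  rw [meanCurvature, smul_eq_zero_iff_right (inv_ne_zero (hF.expU_ne_zero z)), sub_eq_zero] at hmin
  have hproj : ⟪dzbar (dz F) z, F z⟫ = -(expU F z : ℂ) :=
    (wirtingerBar_dotProduct_star_of_const hF.differentiable_dz hF.differentiable
      hF.horizontal_dz z).trans (congrArg Neg.neg (hF.conformal_dz z))
  rwa [hproj, neg_smul] at hmin

theorem dz_dz_dotProduct_self (z : ℂ) : ⟪dz (dz F) z, F z⟫ = 0 :=
  (wirtinger_dotProduct_star_of_const hF.differentiable_dz hF.differentiable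
    hF.horizontal_dz z).trans (neg_eq_zero.mpr (hF.conformal z))

theorem dzbar_dzbar_dotProduct_self (z : ℂ) : ⟪dzbar (dzbar F) z, F z⟫ = 0 :=
  (wirtingerBar_dotProduct_star_of_const hF.differentiable_dzbar hF.differentiable
    hF.horizontal_dzbar z).trans (neg_eq_zero.mpr (hF.dotProduct_dzbar_dz z))

theorem dotProduct_dzbar_dz_self {V : C3} {z : ℂ} (hV : ⟪V, F z⟫ = 0) :
    ⟪V, dzbar (dz F) z⟫ = 0 := by
  rw [hF.dzbar_dz, star_neg, dotProduct_neg, star_smul, dotProduct_smul, hV, smul_zero, neg_zero]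

theorem dz_dz_dotProduct_dz (z : ℂ) :
    ⟪dz (dz F) z, dz F z⟫ = wirtinger (cexpU F) z := by
  rw [hF.cexpU_eq, wirtinger_dotProduct_star hF.differentiable_dz hF.differentiable_dz,
    wirtinger_eq_dz, wirtingerBar_eq_dzbar,
    hF.dotProduct_dzbar_dz_self (hF.horizontal_dz z), add_zero]

theorem dzbar_dzbar_dotProduct_dzbar (z : ℂ) :
    ⟪dzbar (dzbar F) z, dzbar F z⟫ = wirtingerBar (cexpU F) z := by
  have hW : cexpU F = fun z => ⟪dzbar F z, dzbar F z⟫ := (funext hF.conformal_dzbar).symm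
  rw [hW, wirtingerBar_dotProduct_star hF.differentiable_dzbar hF.differentiable_dzbar,
    wirtinger_eq_dz, wirtingerBar_eq_dzbar, ← hF.dzbar_dz_eq_dz_dzbar,
    hF.dotProduct_dzbar_dz_self (hF.horizontal_dzbar z), add_zero]

theorem dzbar_dzbar_dotProduct_dz (z : ℂ) :
    ⟪dzbar (dzbar F) z, dz F z⟫ = -star (hopf F z) :=
  (wirtingerBar_dotProduct_star_of_const hF.differentiable_dzbar hF.differentiable_dz
    hF.dotProduct_dzbar_dz z).trans (congrArg Neg.neg (Matrix.dotProduct_star _ _))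

theorem expU_smul_dz_dz (z : ℂ) :
    (expU F z : ℂ) • dz (dz F) z =
      wirtinger (cexpU F) z • dz F z + hopf F z • dzbar F z := by
  rw [hF.frame_expansion, hF.dz_dz_dotProduct_dz, hF.dz_dz_dotProduct_self, mul_zero, zero_smul,
    add_zero, hopf]

theorem expU_smul_dzbar_dzbar (z : ℂ) :
    (expU F z : ℂ) • dzbar (dzbar F) z =
      wirtingerBar (cexpU F) z • dzbar F z - star (hopf F z) • dz F z := by
  rw [hF.frame_expansion, hF.dzbar_dzbar_dotProduct_dz, hF.dzbar_dzbar_dotProduct_dzbar,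
    hF.dzbar_dzbar_dotProduct_self]
  module

theorem dzbar_dz_dz (z : ℂ) :
    dzbar (dz (dz F)) z =
      -(wirtinger (cexpU F) z • F z + (expU F z : ℂ) • dz F z) := by
  have hcomm : dzbar (dz (dz F)) z = dz (dzbar (dz F)) z := wirtingerBar_wirtinger hF.contDiff_dz z
  rw [hcomm, funext hF.dzbar_dz, ← wirtinger_eq_dz, wirtinger_neg]
  exact congrArg Neg.neg (wirtinger_smul hF.differentiable_cexpU hF.differentiable z)

theorem wirtingerBar_hopf (z : ℂ) : wirtingerBar (hopf F) z = 0 := by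
  have hzzb : ⟪dz (dz F) z, dz (dzbar F) z⟫ = 0 := by
    rw [← hF.dzbar_dz_eq_dz_dzbar, hF.dotProduct_dzbar_dz_self (hF.dz_dz_dotProduct_self z)]
  calc wirtingerBar (hopf F) z
      = ⟪dzbar (dz (dz F)) z, dzbar F z⟫ + ⟪dz (dz F) z, dz (dzbar F) z⟫ :=
        wirtingerBar_dotProduct_star hF.differentiable_dz_dz hF.differentiable_dzbar z
    _ = 0 := by
        rw [hzzb, hF.dzbar_dz_dz, neg_dotProduct, add_dotProduct, smul_dotProduct, smul_dotProduct,
          hF.conformal, Matrix.dotProduct_star (F z), hF.horizontal_dzbar, star_zero]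
        simp

theorem expU_mul_wirtingerBar_wirtinger_cexpU (z : ℂ) :
    (expU F z : ℂ) * wirtingerBar (wirtinger (cexpU F)) z =
      wirtinger (cexpU F) z * star (wirtinger (cexpU F) z) +
        hopf F z * star (hopf F z) - (expU F z : ℂ) ^ 3 := by
  have hzz : (expU F z : ℂ) * ⟪dz (dz F) z, dz (dz F) z⟫ =
      wirtinger (cexpU F) z * star (wirtinger (cexpU F) z) +
        hopf F z * star (hopf F z) := by
    rw [← smul_eq_mul, ← smul_dotProduct, hF.expU_smul_dz_dz, add_dotProduct, smul_dotProduct,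
      smul_dotProduct, Matrix.dotProduct_star (dz F z), Matrix.dotProduct_star (dzbar F z),
      hF.dz_dz_dotProduct_dz, ← hopf, smul_eq_mul, smul_eq_mul]
  have hW : wirtingerBar (wirtinger (cexpU F)) z =
      ⟪dzbar (dz (dz F)) z, dz F z⟫ + ⟪dz (dz F) z, dz (dz F) z⟫ := by
    rw [show wirtinger (cexpU F) = _ from (funext hF.dz_dz_dotProduct_dz).symm]
    exact wirtingerBar_dotProduct_star hF.differentiable_dz_dz hF.differentiable_dz z
  have hzzzb : ⟪dzbar (dz (dz F)) z, dz F z⟫ = -(expU F z : ℂ) ^ 2 := by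
    rw [hF.dzbar_dz_dz, neg_dotProduct, add_dotProduct, smul_dotProduct, smul_dotProduct,
      hF.conformal_dz, Matrix.dotProduct_star (F z), hF.horizontal_dz, star_zero]
    simp [sq]
  rw [hW, mul_add, hzz, hzzzb]
  ring

end IsMinimalLagrangianLift

end StructureEquations

section Reduction

theorem dirDeriv_comp_im {E : Type*} [NormedAddCommGroup E] [NormedSpace ℝ E] {g : ℝ → E}
    (hg : Differentiable ℝ g) (w z : ℂ) :
    dirDeriv w (fun z => g z.im) z = w.im • deriv g z.im :=
  congrArg (fun L : ℂ →L[ℝ] E => L w)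
    ((hg z.im).hasDerivAt.hasFDerivAt.comp z imCLM.hasFDerivAt).fderiv

theorem deriv_ofReal_comp {g : ℝ → ℝ} (hg : Differentiable ℝ g) (y : ℝ) :
    deriv (fun y => (g y : ℂ)) y = ((deriv g y : ℝ) : ℂ) :=
  (hg y).hasDerivAt.ofReal_comp.deriv

section Wirtinger

variable {E : Type*} [NormedAddCommGroup E] [NormedSpace ℂ E] {g : ℝ → E}

theorem wirtinger_comp_im (hg : Differentiable ℝ g) (z : ℂ) :
    wirtinger (fun z => g z.im) z = (-I / 2) • deriv g z.im := by
  rw [wirtinger, dirDeriv_comp_im hg, dirDeriv_comp_im hg, one_im, I_im]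
  module

theorem wirtingerBar_comp_im (hg : Differentiable ℝ g) (z : ℂ) :
    wirtingerBar (fun z => g z.im) z = (I / 2) • deriv g z.im := by
  rw [wirtingerBar, dirDeriv_comp_im hg, dirDeriv_comp_im hg, one_im, I_im]
  module

end Wirtinger

theorem eq_of_wirtingerBar_eq_zero_of_re_eq_zero {g : ℂ → ℂ} (hg : Differentiable ℝ g)
    (hbar : ∀ z, wirtingerBar g z = 0) (hre : ∀ z, (g z).re = 0) (z w : ℂ) : g z = g w := by
  have dirDeriv_re (v z : ℂ) : (dirDeriv v g z).re = 0 := by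
    rw [← reCLM_apply, ← dirDeriv_clm_comp reCLM hg]
    simp [hre, dirDeriv]
  have dirDeriv_I (z : ℂ) : dirDeriv I g z = I * dirDeriv 1 g z := by
    rw [dirDeriv_I_eq, dirDeriv_one_eq, hbar, sub_zero, add_zero, smul_eq_mul]
  have dirDeriv_one (z : ℂ) : dirDeriv 1 g z = 0 :=
    Complex.ext (dirDeriv_re 1 z) (by simpa [dirDeriv_I] using dirDeriv_re I z)
  refine eq_of_dirDeriv_eq_zero hg (fun v z => ?_) z w
  have hv : v = v.re • (1 : ℂ) + v.im • I := by simp [re_add_im]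
  rw [dirDeriv, hv, map_add, map_smul, map_smul, ← dirDeriv, ← dirDeriv, dirDeriv_I, dirDeriv_one]
  simp

/-- Positive solutions of the Gauss equation `(log v)'' = 4 ρ² / v² - 4 v`, in integrated form: the
constant `β` is the value of the first integral obtained by multiplying with `(log v)'`. -/
structure IsProfile (v : ℝ → ℝ) (β ρ : ℝ) : Prop where
  pos : ∀ y, 0 < v y
  differentiable : Differentiable ℝ v
  hasDerivAt_deriv : ∀ y, HasDerivAt (deriv v) (4 * β * v y - 12 * v y ^ 2) y
  energy : ∀ y, deriv v y ^ 2 / 4 + ρ ^ 2 + 2 * v y ^ 3 = β * v y ^ 2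

theorem exists_isProfile {v : ℝ → ℝ} {ρ : ℝ} (hpos : ∀ y, 0 < v y) (hv : Differentiable ℝ v)
    (hv' : Differentiable ℝ (deriv v))
    (gauss : ∀ y, v y * deriv (deriv v) y = deriv v y ^ 2 + 4 * ρ ^ 2 - 4 * v y ^ 3) :
    ∃ β, IsProfile v β ρ := by
  let energy (y : ℝ) : ℝ := (deriv v y ^ 2 / 4 + ρ ^ 2 + 2 * v y ^ 3) / v y ^ 2
  have denergy (y : ℝ) : HasDerivAt energy 0 y := by
    have hnum := ((((hv' y).hasDerivAt.pow 2).div_const 4).add_const (ρ ^ 2)).add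
      (((hv y).hasDerivAt.pow 3).const_mul 2)
    refine (hnum.div ((hv y).hasDerivAt.pow 2) (pow_ne_zero 2 (hpos y).ne')).congr_deriv ?_
    simp only [Pi.add_apply, Pi.pow_apply, div_eq_zero_iff]
    left
    push_cast
    linear_combination (v y * deriv v y / 2) * gauss y
  have henergy (y : ℝ) : deriv v y ^ 2 / 4 + ρ ^ 2 + 2 * v y ^ 3 = energy 0 * v y ^ 2 := by
    rw [is_const_of_deriv_eq_zero (fun y => (denergy y).differentiableAt)
      (fun y => (denergy y).deriv) 0 y, div_mul_cancel₀ _ (pow_ne_zero 2 (hpos y).ne')]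
  refine ⟨energy 0, hpos, hv, fun y => (hv' y).hasDerivAt.congr_deriv ?_, henergy⟩
  apply mul_left_cancel₀ (hpos y).ne'
  linear_combination gauss y + 4 * henergy y

/-- The linear system satisfied by a minimal Lagrangian lift with conformal factor `v (im z)` and
Hopf coefficient `-iρ`.  Unlike the property of being such a lift, it is preserved by linear
combinations and by `∂ₓ`. -/
structure StructureEquations {E : Type*} [NormedAddCommGroup E] [NormedSpace ℂ E] (v : ℝ → ℝ)
    (ρ : ℝ) (G : ℂ → E) : Prop where
  smooth : ContDiff ℝ ∞ G
  xx : ∀ z, (v z.im : ℂ) • dirDeriv 1 (dirDeriv 1 G) z =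
    (-(deriv v z.im / 2) : ℂ) • dirDeriv I G z + (-(I * ρ)) • dirDeriv 1 G z +
      (-(2 * (v z.im : ℂ) ^ 2)) • G z
  xy : ∀ z, (v z.im : ℂ) • dirDeriv 1 (dirDeriv I G) z =
    (deriv v z.im / 2 : ℂ) • dirDeriv 1 G z + (I * ρ) • dirDeriv I G z
  laplace : ∀ z, dirDeriv I (dirDeriv I G) z =
    (-(4 * v z.im : ℂ)) • G z - dirDeriv 1 (dirDeriv 1 G) z

namespace IsMinimalLagrangianLift

variable {F : ℂ → C3} {f : ℂ → CP2} (hF : IsMinimalLagrangianLift F f)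
include hF

theorem contDiff_expU : ContDiff ℝ ∞ (expU F) := by
  have hdz (i : Fin 3) : ContDiff ℝ ∞ fun z => dz F z i := contDiff_pi.mp hF.contDiff_dz i
  have hstar (i : Fin 3) : ContDiff ℝ ∞ fun z => star (dz F z i) := conjCLE.contDiff.comp (hdz i)
  have hdot : ContDiff ℝ ∞ fun z => ∑ i, dz F z i * star (dz F z i) :=
    ContDiff.sum fun i _ => (hdz i).mul (hstar i)
  exact reCLM.contDiff.comp hdot

theorem expU_eq_expU_im (hmetric : ∀ z (t : ℝ), metricU F (z + t) = metricU F z) (z : ℂ) :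
    expU F z = expU F (z.im * I) := by
  have h : metricU F (z.im * I + z.re) = metricU F (z.im * I) := hmetric _ _
  rw [add_comm, re_add_im] at h
  exact Real.log_injOn_pos (hF.immersion _) (hF.immersion _) h

theorem exists_hopf_eq (him : ∀ z, (hopf F z).re = 0) : ∃ ρ : ℝ, ∀ z, hopf F z = -(I * ρ) := by
  refine ⟨-(hopf F 0).im, fun z => ?_⟩
  have hconst : hopf F z = hopf F 0 := eq_of_wirtingerBar_eq_zero_of_re_eq_zero
    (differentiable_dotProduct_star hF.differentiable_dz_dz hF.differentiable_dzbar)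
    hF.wirtingerBar_hopf him z 0
  rw [hconst]
  exact Complex.ext (by simp [him]) (by simp)

variable {v : ℝ → ℝ} {ρ : ℝ} (hv : ∀ z, expU F z = v z.im)
include hv

theorem contDiff_profile : ContDiff ℝ ∞ v := by
  have hline : v = fun y : ℝ => expU F (y * I) := funext fun y => by simp [hv]
  rw [hline]
  exact hF.contDiff_expU.comp (ofRealCLM.contDiff.mul contDiff_const)

theorem differentiable_profile : Differentiable ℝ v :=
  (hF.contDiff_profile hv).differentiable (by simp)

theorem differentiable_deriv_profile : Differentiable ℝ (deriv v) :=
  ((contDiff_infty_iff_deriv.mp (hF.contDiff_profile hv)).2).differentiable (by simp)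

omit hF in
theorem cexpU_eq_comp_im : cexpU F = fun z => (fun y => (v y : ℂ)) z.im :=
  funext fun z => congrArg ofReal (hv z)

theorem wirtinger_cexpU : wirtinger (cexpU F) = fun z => -I / 2 * (deriv v z.im : ℝ) := by
  have hd := hF.differentiable_profile hv
  funext z
  rw [cexpU_eq_comp_im hv,
    wirtinger_comp_im fun y => (hd y).hasDerivAt.ofReal_comp.differentiableAt,
    deriv_ofReal_comp hd, smul_eq_mul]

theorem wirtingerBar_cexpU (z : ℂ) : wirtingerBar (cexpU F) z = I / 2 * (deriv v z.im : ℝ) := by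
  have hd := hF.differentiable_profile hv
  rw [cexpU_eq_comp_im hv,
    wirtingerBar_comp_im fun y => (hd y).hasDerivAt.ofReal_comp.differentiableAt,
    deriv_ofReal_comp hd, smul_eq_mul]

theorem wirtingerBar_wirtinger_cexpU (z : ℂ) :
    wirtingerBar (wirtinger (cexpU F)) z = (deriv (deriv v) z.im / 4 : ℝ) := by
  have hg (y : ℝ) : HasDerivAt (fun y => -I / 2 * ((deriv v y : ℝ) : ℂ))
      (-I / 2 * (deriv (deriv v) y : ℝ)) y :=
    ((hF.differentiable_deriv_profile hv y).hasDerivAt.ofReal_comp).const_mul _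
  rw [hF.wirtinger_cexpU hv, wirtingerBar_comp_im fun y => (hg y).differentiableAt, (hg z.im).deriv,
    smul_eq_mul]
  push_cast
  linear_combination (-((deriv (deriv v) z.im : ℝ) : ℂ) / 4) * I_mul_I

variable (hρ : ∀ z, hopf F z = -(I * ρ))
include hρ

theorem exists_isProfile : ∃ β, IsProfile v β ρ := by
  refine MinLag.exists_isProfile (fun y => ?_) (hF.differentiable_profile hv)
    (hF.differentiable_deriv_profile hv) fun y => ?_
  · simpa [hv] using hF.immersion (y * I)
  · have gauss := hF.expU_mul_wirtingerBar_wirtinger_cexpU (y * I)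
    rw [hF.wirtingerBar_wirtinger_cexpU hv] at gauss
    simp only [hF.wirtinger_cexpU hv, hρ, hv, star_neg,
      star_mul', star_div₀, RCLike.star_def, conj_I, conj_ofReal, map_ofNat, mul_I_im,
      ofReal_re] at gauss
    refine ofReal_injective ?_
    push_cast at gauss ⊢
    linear_combination 4 * gauss + (-((deriv v y : ℝ) : ℂ) ^ 2 - 4 * ρ ^ 2) * I_mul_I

theorem structureEquations : StructureEquations v ρ F := by
  have hzz (z : ℂ) : (v z.im : ℂ) • dz (dz F) z =
      (-I / 2 * (deriv v z.im : ℝ)) • dz F z - (I * ρ) • dzbar F z := by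
    rw [← hv, hF.expU_smul_dz_dz, hF.wirtinger_cexpU hv, hρ]
    module
  have hzbzb (z : ℂ) : (v z.im : ℂ) • dzbar (dzbar F) z =
      (I / 2 * (deriv v z.im : ℝ)) • dzbar F z - (I * ρ) • dz F z := by
    have hstar : star (-(I * ρ) : ℂ) = I * ρ := by simp
    rw [← hv, hF.expU_smul_dzbar_dzbar, hF.wirtingerBar_cexpU hv, hρ, hstar]
  refine ⟨hF.smooth, fun z => ?_, fun z => ?_, fun z => ?_⟩
  · have hxx := dirDeriv_one_one hF.smooth z
    simp only [wirtinger_eq_dz, wirtingerBar_eq_dzbar, hF.dzbar_dz, hv] at hxx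
    rw [hxx, smul_add, smul_add, hzz, hzbzb, dirDeriv_one_eq, dirDeriv_I_eq, wirtinger_eq_dz,
      wirtingerBar_eq_dzbar]
    match_scalars <;> ring
  · have hxy := dirDeriv_one_I hF.smooth z
    simp only [wirtinger_eq_dz, wirtingerBar_eq_dzbar] at hxy
    rw [hxy, smul_comm, smul_sub, hzz, hzbzb, dirDeriv_one_eq, dirDeriv_I_eq, wirtinger_eq_dz,
      wirtingerBar_eq_dzbar]
    match_scalars <;> linear_combination (-((deriv v z.im : ℝ) : ℂ) / 2) * I_mul_I
  · have hlaplace := dirDeriv_one_one_add_dirDeriv_I_I hF.smooth z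
    simp only [wirtinger_eq_dz, wirtingerBar_eq_dzbar, hF.dzbar_dz, hv] at hlaplace
    linear_combination (norm := module) hlaplace

end IsMinimalLagrangianLift

end Reduction

section LinearODE

variable {E : Type*} [NormedAddCommGroup E] [NormedSpace ℝ E]

theorem eq_zero_of_hasDerivAt_clm_apply {A : ℝ → E →L[ℝ] E} (hA : Continuous A) {f : ℝ → E}
    (hf : ∀ t, HasDerivAt f (A t (f t)) t) {t₀ : ℝ} (h₀ : f t₀ = 0) (t : ℝ) : f t = 0 := by
  obtain ⟨a, b, ht₀, ht⟩ : ∃ a b, t₀ ∈ Set.Ioo a b ∧ t ∈ Set.Ioo a b :=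
    ⟨min t₀ t - 1, max t₀ t + 1, by grind, by grind⟩
  obtain ⟨C, hC⟩ := isCompact_Icc.exists_bound_of_continuousOn (s := Set.Icc a b) hA.continuousOn
  have hlip (s : ℝ) (hs : s ∈ Set.Ioo a b) : LipschitzOnWith C.toNNReal (A s) Set.univ :=
    ((A s).lipschitz.weaken (NNReal.le_toNNReal_of_coe_le
      (hC s (Set.Ioo_subset_Icc_self hs)))).lipschitzOnWith
  exact ODE_solution_unique_of_mem_Ioo (g := fun _ => 0) hlip ht₀ (fun s _ => ⟨hf s, trivial⟩)
    (fun s _ => ⟨(hasDerivAt_const s (0 : E)).congr_deriv (map_zero (A s)).symm, trivial⟩) h₀ ht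

theorem eq_zero_of_hasDerivAt_smul {e q : ℝ → E} {b : ℝ → ℝ} (hb : Continuous b)
    (he : ∀ t, HasDerivAt e (q t) t) (hq : ∀ t, HasDerivAt q (b t • e t) t) {t₀ : ℝ}
    (he₀ : e t₀ = 0) (hq₀ : q t₀ = 0) (t : ℝ) : e t = 0 := by
  let A (t : ℝ) : E × E →L[ℝ] E × E :=
    (ContinuousLinearMap.snd ℝ E E).prod (b t • ContinuousLinearMap.fst ℝ E E)
  have hA : Continuous A := (ContinuousLinearMap.prodₗᵢ ℝ).continuous.comp
    (continuous_const.prodMk (hb.smul continuous_const))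
  exact congrArg Prod.fst (eq_zero_of_hasDerivAt_clm_apply hA (f := fun t => (e t, q t))
    (fun t => (he t).prodMk (hq t)) (Prod.ext he₀ hq₀) t)

variable {g g' : ℝ → E} {b : ℝ → ℝ} {c : ℝ} (hb : Continuous b)
  (hg : ∀ y, HasDerivAt g (g' y) y) (hg' : ∀ y, HasDerivAt g' (b y • g y) y)
  (hsymm : ∀ s, b (c + s) = b (c - s))
include hb hg hg' hsymm

theorem even_of_deriv_eq_zero (h₀ : g' c = 0) (s : ℝ) : g (c + s) = g (c - s) := by
  refine sub_eq_zero.mp (eq_zero_of_hasDerivAt_smul (e := fun s => g (c + s) - g (c - s))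
    (q := fun s => g' (c + s) + g' (c - s)) (b := fun s => b (c + s)) (t₀ := 0) (by fun_prop)
    (fun s => (((hg _).comp_const_add c s).sub ((hg _).comp_const_sub c s)).congr_deriv (by simp))
    (fun s => (((hg' _).comp_const_add c s).add ((hg' _).comp_const_sub c s)).congr_deriv ?_)
    (by simp) (by simp [h₀]) s)
  rw [smul_sub, hsymm s]
  exact (sub_eq_add_neg _ _).symm

theorem odd_of_eq_zero (h₀ : g c = 0) (s : ℝ) : g (c + s) = -g (c - s) := by
  refine add_eq_zero_iff_eq_neg.mp (eq_zero_of_hasDerivAt_smul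
    (e := fun s => g (c + s) + g (c - s)) (q := fun s => g' (c + s) - g' (c - s))
    (b := fun s => b (c + s)) (t₀ := 0) (by fun_prop)
    (fun s => (((hg _).comp_const_add c s).add ((hg _).comp_const_sub c s)).congr_deriv
      (by simp [sub_eq_add_neg]))
    (fun s => (((hg' _).comp_const_add c s).sub ((hg' _).comp_const_sub c s)).congr_deriv ?_)
    (by simp [h₀]) (by simp) s)
  rw [smul_add, hsymm s, sub_neg_eq_add]

end LinearODE

section JacobiElliptic

/-- The incomplete elliptic integral of the first kind, as a function of the modulus `k` and the
amplitude `α`. -/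
def ellipticF (k α : ℝ) : ℝ := ∫ x in (0 : ℝ)..α, 1 / √(1 - k ^ 2 * Real.sin x ^ 2)

theorem ellipticF_zero (k : ℝ) : ellipticF k 0 = 0 := by simp [ellipticF]

theorem ellipticF_pi_div_two (k : ℝ) : ellipticF k (Real.pi / 2) = ellipticK k := rfl

variable {k : ℝ} (hk : k ^ 2 < 1)
include hk

theorem one_sub_sq_mul_sin_sq_pos (α : ℝ) : 0 < 1 - k ^ 2 * Real.sin α ^ 2 := by
  have := mul_le_mul_of_nonneg_left (Real.sin_sq_le_one α) (sq_nonneg k)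
  linarith

theorem hasDerivAt_ellipticF (α : ℝ) :
    HasDerivAt (ellipticF k) (1 / √(1 - k ^ 2 * Real.sin α ^ 2)) α := by
  have hc : Continuous fun x => 1 / √(1 - k ^ 2 * Real.sin x ^ 2) :=
    continuous_const.div (by fun_prop) fun x =>
      (Real.sqrt_pos.mpr (one_sub_sq_mul_sin_sq_pos hk x)).ne'
  exact intervalIntegral.integral_hasDerivAt_right (hc.intervalIntegrable 0 α)
    hc.stronglyMeasurable.stronglyMeasurableAtFilter hc.continuousAt

theorem ellipticF_neg (α : ℝ) : ellipticF k (-α) = -ellipticF k α := by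
  have hd (x : ℝ) : HasDerivAt (fun x => ellipticF k (-x) + ellipticF k x) 0 x :=
    (((hasDerivAt_ellipticF hk (-x)).comp x (hasDerivAt_neg x)).add
      (hasDerivAt_ellipticF hk x)).congr_deriv (by simp)
  have hconst := is_const_of_deriv_eq_zero (fun x => (hd x).differentiableAt)
    (fun x => (hd x).deriv) α 0
  simp only [neg_zero, ellipticF_zero, add_zero] at hconst
  exact eq_neg_of_add_eq_zero_left hconst

theorem ellipticF_add_pi (α : ℝ) :
    ellipticF k (α + Real.pi) = ellipticF k α + 2 * ellipticK k := by
  have hd (x : ℝ) : HasDerivAt (fun x => ellipticF k (x + Real.pi) - ellipticF k x) 0 x :=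
    (((hasDerivAt_ellipticF hk (x + Real.pi)).comp_add_const x Real.pi).sub
      (hasDerivAt_ellipticF hk x)).congr_deriv (by simp)
  have hconst := is_const_of_deriv_eq_zero (fun x => (hd x).differentiableAt)
    (fun x => (hd x).deriv) α (-(Real.pi / 2))
  rw [ellipticF_neg hk, show -(Real.pi / 2) + Real.pi = Real.pi / 2 by ring,
    ellipticF_pi_div_two] at hconst
  linarith

theorem ellipticF_int_mul_pi (n : ℤ) : ellipticF k (n * Real.pi) = n * (2 * ellipticK k) := by
  induction n using Int.induction_on with
  | zero => simp [ellipticF_zero]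
  | succ n ih =>
    have h := ellipticF_add_pi hk (n * Real.pi)
    push_cast at ih ⊢
    rw [add_one_mul, h, ih, add_one_mul]
  | pred n ih =>
    have h := ellipticF_add_pi hk ((-(n : ℝ) - 1) * Real.pi)
    rw [sub_one_mul, sub_add_cancel] at h
    push_cast at ih ⊢
    rw [sub_one_mul]
    linarith

theorem ellipticF_strictMono : StrictMono (ellipticF k) :=
  strictMono_of_hasDerivAt_pos (hasDerivAt_ellipticF hk) fun α =>
    one_div_pos.mpr (Real.sqrt_pos.mpr (one_sub_sq_mul_sin_sq_pos hk α))

theorem le_ellipticF {α : ℝ} (hα : 0 ≤ α) : α ≤ ellipticF k α := by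
  have hd (x : ℝ) : HasDerivAt (fun x => ellipticF k x - x) _ x :=
    (hasDerivAt_ellipticF hk x).sub (hasDerivAt_id x)
  have hmono : Monotone fun x => ellipticF k x - x := by
    refine monotone_of_deriv_nonneg (fun x => (hd x).differentiableAt) fun x => ?_
    rw [(hd x).deriv, sub_nonneg, le_div_iff₀ (Real.sqrt_pos.mpr (one_sub_sq_mul_sin_sq_pos hk x)),
      one_mul, Real.sqrt_le_one]
    have : 0 ≤ k ^ 2 * Real.sin x ^ 2 := by positivity
    linarith
  simpa [ellipticF_zero] using hmono hα

theorem ellipticF_surjective : Function.Surjective (ellipticF k) := by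
  have hcont : Continuous (ellipticF k) :=
    continuous_iff_continuousAt.mpr fun x => (hasDerivAt_ellipticF hk x).continuousAt
  have htop : Filter.Tendsto (ellipticF k) Filter.atTop Filter.atTop :=
    Filter.tendsto_atTop_mono' _ ((Filter.eventually_ge_atTop 0).mono fun x => le_ellipticF hk)
      Filter.tendsto_id
  refine hcont.surjective htop ?_
  rw [show ellipticF k = fun x => -ellipticF k (-x) from
    funext fun x => by rw [ellipticF_neg hk, neg_neg]]
  exact Filter.tendsto_neg_atTop_atBot.comp (htop.comp Filter.tendsto_neg_atBot_atTop)

omit hk in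
/-- Jacobi's amplitude function, the inverse of the incomplete elliptic integral. -/
def amplitude (hk : k ^ 2 < 1) : ℝ ≃o ℝ :=
  ((ellipticF_strictMono hk).orderIsoOfSurjective _ (ellipticF_surjective hk)).symm

theorem amplitude_ellipticF (α : ℝ) : amplitude hk (ellipticF k α) = α :=
  (amplitude hk).apply_symm_apply α

theorem ellipticF_amplitude (u : ℝ) : ellipticF k (amplitude hk u) = u :=
  (amplitude hk).symm_apply_apply u

theorem hasDerivAt_amplitude (u : ℝ) :
    HasDerivAt (amplitude hk) √(1 - k ^ 2 * Real.sin (amplitude hk u) ^ 2) u := by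
  have h := HasDerivAt.of_local_left_inverse (amplitude hk).continuous.continuousAt
    (hasDerivAt_ellipticF hk (amplitude hk u))
    (one_div_pos.mpr (Real.sqrt_pos.mpr (one_sub_sq_mul_sin_sq_pos hk _))).ne'
    (Filter.Eventually.of_forall (ellipticF_amplitude hk))
  rwa [one_div, inv_inv] at h

omit hk in
/-- Jacobi's elliptic function `sn` of modulus `k`. -/
def jacobiSn (hk : k ^ 2 < 1) (u : ℝ) : ℝ := Real.sin (amplitude hk u)

omit hk in
/-- Jacobi's elliptic function `cn` of modulus `k`. -/
def jacobiCn (hk : k ^ 2 < 1) (u : ℝ) : ℝ := Real.cos (amplitude hk u)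

omit hk in
/-- Jacobi's elliptic function `dn` of modulus `k`. -/
def jacobiDn (hk : k ^ 2 < 1) (u : ℝ) : ℝ := √(1 - k ^ 2 * jacobiSn hk u ^ 2)

theorem jacobiCn_sq (u : ℝ) : jacobiCn hk u ^ 2 = 1 - jacobiSn hk u ^ 2 := Real.cos_sq' _

theorem jacobiDn_sq (u : ℝ) : jacobiDn hk u ^ 2 = 1 - k ^ 2 * jacobiSn hk u ^ 2 :=
  Real.sq_sqrt (one_sub_sq_mul_sin_sq_pos hk _).le

theorem hasDerivAt_jacobiSn (u : ℝ) :
    HasDerivAt (jacobiSn hk) (jacobiCn hk u * jacobiDn hk u) u :=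
  (Real.hasDerivAt_sin _).comp u (hasDerivAt_amplitude hk u)

theorem hasDerivAt_jacobiCn (u : ℝ) :
    HasDerivAt (jacobiCn hk) (-(jacobiSn hk u * jacobiDn hk u)) u :=
  ((Real.hasDerivAt_cos _).comp u (hasDerivAt_amplitude hk u)).congr_deriv (neg_mul _ _)

theorem hasDerivAt_jacobiDn (u : ℝ) :
    HasDerivAt (jacobiDn hk) (-(k ^ 2 * (jacobiSn hk u * jacobiCn hk u))) u := by
  have hpos := one_sub_sq_mul_sin_sq_pos hk (amplitude hk u)
  have hdn : 0 < jacobiDn hk u := Real.sqrt_pos.mpr hpos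
  refine ((((hasDerivAt_jacobiSn hk u).pow 2).const_mul (k ^ 2)).const_sub 1).sqrt hpos.ne'
    |>.congr_deriv ?_
  change _ / (2 * jacobiDn hk u) = _
  field_simp
  ring

theorem jacobiSn_zero : jacobiSn hk 0 = 0 := by
  have h : amplitude hk 0 = 0 := by simpa only [ellipticF_zero] using amplitude_ellipticF hk 0
  rw [jacobiSn, h, Real.sin_zero]

theorem jacobiSn_ellipticK : jacobiSn hk (ellipticK k) = 1 := by
  rw [jacobiSn, ← ellipticF_pi_div_two, amplitude_ellipticF, Real.sin_pi_div_two]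

theorem jacobiSn_neg (u : ℝ) : jacobiSn hk (-u) = -jacobiSn hk u := by
  obtain ⟨α, rfl⟩ := ellipticF_surjective hk u
  simp only [jacobiSn, ← ellipticF_neg hk, amplitude_ellipticF, Real.sin_neg]

theorem jacobiSn_add_two_mul_ellipticK (u : ℝ) :
    jacobiSn hk (u + 2 * ellipticK k) = -jacobiSn hk u := by
  obtain ⟨α, rfl⟩ := ellipticF_surjective hk u
  simp only [jacobiSn, ← ellipticF_add_pi hk, amplitude_ellipticF, Real.sin_add_pi]

theorem exists_int_of_jacobiSn_eq_zero {u : ℝ} (hu : jacobiSn hk u = 0) :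
    ∃ n : ℤ, u = n * (2 * ellipticK k) := by
  obtain ⟨n, hn⟩ := Real.sin_eq_zero_iff.mp hu
  exact ⟨n, by rw [← ellipticF_int_mul_pi hk, hn, ellipticF_amplitude]⟩

theorem exists_jacobiSn_eq {s : ℝ} (h₁ : -1 ≤ s) (h₂ : s ≤ 1) : ∃ u, jacobiSn hk u = s :=
  ⟨ellipticF k (Real.arcsin s), by rw [jacobiSn, amplitude_ellipticF, Real.sin_arcsin h₁ h₂]⟩

end JacobiElliptic

section Roots

/-- `A₁`, `A₂` and `-A₃` are the roots of `w³ - (β/2) w² + ρ²/2`, in Vieta's form.  For a profile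
`v`, this cubic takes the value `-v'²/8` at `w = v`. -/
structure IsRootTriple (β ρ A₁ A₂ A₃ : ℝ) : Prop where
  pos₂ : 0 < A₂
  lt : A₂ < A₁
  pos₃ : 0 < A₃
  sum_eq : β = 2 * (A₁ + A₂ - A₃)
  mul_eq : A₁ * A₂ = A₃ * (A₁ + A₂)
  prod_eq : ρ ^ 2 = 2 * (A₁ * A₂ * A₃)

theorem exists_isRootTriple {β ρ w : ℝ} (hρ : ρ ≠ 0) (hw : 0 < w)
    (hneg : w ^ 3 - β / 2 * w ^ 2 + ρ ^ 2 / 2 < 0) : ∃ A₁ A₂ A₃, IsRootTriple β ρ A₁ A₂ A₃ := by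
  let p (x : ℝ) : ℝ := x ^ 3 - β / 2 * x ^ 2 + ρ ^ 2 / 2
  have hp : Continuous p := by fun_prop
  have hρ2 : 0 < ρ ^ 2 := by positivity
  have hβ : w < β := by
    by_contra! h
    have : β / 2 * w ^ 2 ≤ w / 2 * w ^ 2 := by gcongr
    nlinarith [pow_pos hw 3]
  have hpβ : 0 < p β := by
    have : 0 < β ^ 3 / 2 + ρ ^ 2 / 2 := by have := hw.trans hβ; positivity
    linear_combination this
  obtain ⟨A₂, ⟨h₂, h₂w⟩, hA₂⟩ := intermediate_value_Ioo' hw.le hp.continuousOn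
    (show (0 : ℝ) ∈ Set.Ioo _ _ from ⟨hneg, by simp only [p]; linarith⟩)
  obtain ⟨A₁, ⟨h₁w, -⟩, hA₁⟩ := intermediate_value_Ioo hβ.le hp.continuousOn
    (show (0 : ℝ) ∈ Set.Ioo _ _ from ⟨hneg, hpβ⟩)
  have hlt : A₂ < A₁ := h₂w.trans h₁w
  have hmul : A₁ * A₂ = (A₁ + A₂ - β / 2) * (A₁ + A₂) := by
    apply mul_left_cancel₀ (sub_pos.mpr hlt).ne'
    simp only [p] at hA₁ hA₂
    linear_combination hA₂ - hA₁
  refine ⟨A₁, A₂, A₁ + A₂ - β / 2, h₂, hlt, ?_, by ring, hmul, ?_⟩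
  · have : 0 < (A₁ + A₂ - β / 2) * (A₁ + A₂) := hmul ▸ mul_pos (h₂.trans hlt) h₂
    exact pos_of_mul_pos_left this (by linarith)
  · linear_combination 2 * hA₁ + 2 * A₁ * hmul

/-- The distance between consecutive extrema of the profile with roots `A₁`, `A₂`, `-A₃`. -/
def jacobiHalfPeriod (A₁ A₂ A₃ : ℝ) : ℝ :=
  ellipticK √((A₁ - A₂) / (A₁ + A₃)) / √(2 * (A₁ + A₃))

namespace IsRootTriple

variable {β ρ A₁ A₂ A₃ : ℝ} (hA : IsRootTriple β ρ A₁ A₂ A₃)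
include hA

theorem pos₁ : 0 < A₁ := hA.pos₂.trans hA.lt

theorem sq_div_eq_sub : ρ ^ 2 / (2 * A₁ ^ 2) = A₂ - A₃ := by
  have := hA.pos₁
  rw [hA.prod_eq, div_eq_iff (by positivity)]
  linear_combination -2 * A₁ * hA.mul_eq

theorem sqrt_eq_add : √((A₂ - A₃) ^ 2 + 4 * A₁ * (A₂ - A₃)) = A₂ + A₃ := by
  rw [← Real.sqrt_sq (add_pos hA.pos₂ hA.pos₃).le]
  congr 1
  linear_combination 4 * hA.mul_eq

theorem modulus_sq : √((A₁ - A₂) / (A₁ + A₃)) ^ 2 = (A₁ - A₂) / (A₁ + A₃) :=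
  Real.sq_sqrt (div_nonneg (sub_nonneg.mpr hA.lt.le) (add_pos hA.pos₁ hA.pos₃).le)

theorem mul_modulus_sq : (A₁ + A₃) * √((A₁ - A₂) / (A₁ + A₃)) ^ 2 = A₁ - A₂ := by
  rw [hA.modulus_sq, mul_div_cancel₀ _ (add_pos hA.pos₁ hA.pos₃).ne']

theorem modulus_sq_lt_one : √((A₁ - A₂) / (A₁ + A₃)) ^ 2 < 1 := by
  rw [hA.modulus_sq, div_lt_one (add_pos hA.pos₁ hA.pos₃)]
  linarith [hA.pos₂, hA.pos₃]

theorem frequency_sq : √(2 * (A₁ + A₃)) ^ 2 = 2 * (A₁ + A₃) :=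
  Real.sq_sqrt (mul_nonneg two_pos.le (add_pos hA.pos₁ hA.pos₃).le)

theorem frequency_pos : 0 < √(2 * (A₁ + A₃)) :=
  Real.sqrt_pos.mpr (mul_pos two_pos (add_pos hA.pos₁ hA.pos₃))

theorem halfPeriod_eq {F : ℂ → C3} (h₁ : a₁ F = A₁) (hρ : ‖hopf F 0‖ ^ 2 = ρ ^ 2) :
    halfPeriod F = jacobiHalfPeriod A₁ A₂ A₃ := by
  have hδ : delta F = A₂ - A₃ := by rw [delta, h₁, hρ, hA.sq_div_eq_sub]
  have h₂ : a₂ F = A₂ := by rw [a₂, hδ, h₁, hA.sqrt_eq_add]; ring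
  have h₃ : a₃ F = A₃ := by rw [a₃, hδ, h₁, hA.sqrt_eq_add]; ring
  rw [halfPeriod, h₁, h₂, h₃, jacobiHalfPeriod]

end IsRootTriple

end Roots

section Profile

/-- The solution `A₁ - (A₁ - A₂) sn²(r s)` of the profile equation with maximum at `s = 0`, where
`k² = (A₁ - A₂) / (A₁ + A₃)` and `r² = 2 (A₁ + A₃)`. -/
def jacobiProfile {β ρ A₁ A₂ A₃ : ℝ} (hA : IsRootTriple β ρ A₁ A₂ A₃) (s : ℝ) : ℝ :=
  A₁ - (A₁ - A₂) * jacobiSn hA.modulus_sq_lt_one (√(2 * (A₁ + A₃)) * s) ^ 2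

/-- `v` oscillates about its maximum `A₁` at `y₀` and the value `A₂` at `y₀ + T`, and takes the
value `A₁` only at the points of `y₀ + 2Tℤ`. -/
structure IsOscillation (v : ℝ → ℝ) (A₁ A₂ T y₀ : ℝ) : Prop where
  apply_max : v y₀ = A₁
  apply_min : v (y₀ + T) = A₂
  le_max : ∀ y, v y ≤ A₁
  symm_max : ∀ s, v (y₀ + s) = v (y₀ - s)
  symm_min : ∀ s, v (y₀ + T + s) = v (y₀ + T - s)
  exists_int : ∀ s, v (y₀ + s) = A₁ → ∃ n : ℤ, s = n * (2 * T)

variable {β ρ A₁ A₂ A₃ : ℝ} (hA : IsRootTriple β ρ A₁ A₂ A₃)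
include hA

theorem jacobiProfile_neg (s : ℝ) : jacobiProfile hA (-s) = jacobiProfile hA s := by
  rw [jacobiProfile, mul_neg, jacobiSn_neg, neg_sq, jacobiProfile]

theorem jacobiProfile_sub_eq_add (s : ℝ) :
    jacobiProfile hA (jacobiHalfPeriod A₁ A₂ A₃ - s) =
      jacobiProfile hA (jacobiHalfPeriod A₁ A₂ A₃ + s) := by
  have hr := hA.frequency_pos.ne'
  rw [jacobiHalfPeriod, ← jacobiProfile_neg, jacobiProfile, ← neg_sq,
    ← jacobiSn_add_two_mul_ellipticK, jacobiProfile]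
  congr 4
  field_simp
  ring

theorem isOscillation_jacobiProfile :
    IsOscillation (jacobiProfile hA) A₁ A₂ (jacobiHalfPeriod A₁ A₂ A₃) 0 where
  apply_max := by rw [jacobiProfile, mul_zero, jacobiSn_zero]; ring
  apply_min := by
    rw [zero_add, jacobiProfile, jacobiHalfPeriod, mul_div_cancel₀ _ hA.frequency_pos.ne',
      jacobiSn_ellipticK]
    ring
  le_max y := sub_le_self _ (mul_nonneg (sub_pos.mpr hA.lt).le (sq_nonneg _))
  symm_max s := by rw [zero_add, zero_sub, jacobiProfile_neg]
  symm_min s := by rw [zero_add, jacobiProfile_sub_eq_add]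
  exists_int s hs := by
    rw [zero_add, jacobiProfile, sub_eq_self, mul_eq_zero_iff_left (sub_pos.mpr hA.lt).ne',
      sq_eq_zero_iff] at hs
    obtain ⟨n, hn⟩ := exists_int_of_jacobiSn_eq_zero _ hs
    refine ⟨n, ?_⟩
    have hr := hA.frequency_pos.ne'
    rw [jacobiHalfPeriod]
    field_simp
    linear_combination hn

theorem exists_jacobiProfile_eq {c : ℝ} (h₂ : A₂ ≤ c) (h₁ : c ≤ A₁) :
    ∃ s, jacobiProfile hA s = c := by
  have h₁₂ : 0 < A₁ - A₂ := sub_pos.mpr hA.lt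
  have hratio : (A₁ - c) / (A₁ - A₂) ≤ 1 := (div_le_one h₁₂).mpr (by linarith)
  obtain ⟨u, hu⟩ := exists_jacobiSn_eq hA.modulus_sq_lt_one (s := √((A₁ - c) / (A₁ - A₂)))
    (by linarith [Real.sqrt_nonneg ((A₁ - c) / (A₁ - A₂))]) (Real.sqrt_le_one.mpr hratio)
  refine ⟨u / √(2 * (A₁ + A₃)), ?_⟩
  rw [jacobiProfile, mul_div_cancel₀ _ hA.frequency_pos.ne', hu,
    Real.sq_sqrt (div_nonneg (sub_nonneg.mpr h₁) h₁₂.le), mul_div_cancel₀ _ h₁₂.ne', sub_sub_cancel]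

theorem hasDerivAt_jacobiProfile (s : ℝ) : HasDerivAt (jacobiProfile hA)
    (-(2 * (A₁ - A₂) * √(2 * (A₁ + A₃))) * (jacobiSn hA.modulus_sq_lt_one (√(2 * (A₁ + A₃)) * s) *
      jacobiCn hA.modulus_sq_lt_one (√(2 * (A₁ + A₃)) * s) *
      jacobiDn hA.modulus_sq_lt_one (√(2 * (A₁ + A₃)) * s))) s := by
  have hsn := (hasDerivAt_jacobiSn hA.modulus_sq_lt_one (√(2 * (A₁ + A₃)) * s)).comp s
    (hasDerivAt_const_mul (√(2 * (A₁ + A₃))))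
  refine (((hsn.pow 2).const_mul (A₁ - A₂)).const_sub A₁).congr_deriv ?_
  simp only [Function.comp_apply]
  ring

theorem hasDerivAt_deriv_jacobiProfile (s : ℝ) : HasDerivAt (deriv (jacobiProfile hA))
    (4 * β * jacobiProfile hA s - 12 * jacobiProfile hA s ^ 2) s := by
  rw [funext fun s => (hasDerivAt_jacobiProfile hA s).deriv]
  have hlin : HasDerivAt (fun s => √(2 * (A₁ + A₃)) * s) √(2 * (A₁ + A₃)) s :=
    hasDerivAt_const_mul _
  have hk := hA.modulus_sq_lt_one
  have h := (((hasDerivAt_jacobiSn hk _).mul (hasDerivAt_jacobiCn hk _)).mul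
    (hasDerivAt_jacobiDn hk _)).comp s hlin
  refine (h.const_mul (-(2 * (A₁ - A₂) * √(2 * (A₁ + A₃))))).congr_deriv ?_
  rw [jacobiProfile]
  set k := √((A₁ - A₂) / (A₁ + A₃))
  set u := √(2 * (A₁ + A₃)) * s
  calc
    _ = -(2 * (A₁ - A₂) * √(2 * (A₁ + A₃)) ^ 2) * (jacobiCn hk u ^ 2 * jacobiDn hk u ^ 2 -
        jacobiSn hk u ^ 2 * jacobiDn hk u ^ 2 -
        k ^ 2 * (jacobiSn hk u ^ 2 * jacobiCn hk u ^ 2)) := by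
      simp only [Pi.mul_apply]
      ring
    _ = _ := by
      rw [jacobiCn_sq, jacobiDn_sq, hA.frequency_sq]
      generalize jacobiSn hk u ^ 2 = S
      linear_combination -4 * (A₁ - A₂) * (3 * S ^ 2 - 2 * S) * hA.mul_modulus_sq -
        4 * (A₁ - (A₁ - A₂) * S) * hA.sum_eq - 4 * hA.mul_eq

theorem isProfile_jacobiProfile : IsProfile (jacobiProfile hA) β ρ where
  pos s := by
    have hk := hA.modulus_sq_lt_one
    have hS := jacobiCn_sq hk (√(2 * (A₁ + A₃)) * s) ▸ sq_nonneg (jacobiCn hk _)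
    have := mul_nonneg (sub_pos.mpr hA.lt).le hS
    rw [jacobiProfile]
    linarith [hA.pos₂]
  differentiable s := (hasDerivAt_jacobiProfile hA s).differentiableAt
  hasDerivAt_deriv := hasDerivAt_deriv_jacobiProfile hA
  energy s := by
    simp only [(hasDerivAt_jacobiProfile hA s).deriv, jacobiProfile, mul_pow, neg_sq,
      hA.frequency_sq, jacobiCn_sq, jacobiDn_sq]
    generalize jacobiSn _ _ ^ 2 = S
    linear_combination -(2 * (A₁ - A₂) ^ 2 * S ^ 2 * (1 - S)) * hA.mul_modulus_sq -
      (A₁ - (A₁ - A₂) * S) ^ 2 * hA.sum_eq + hA.prod_eq -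
      2 * (A₁ - (A₁ - A₂) * S) * hA.mul_eq

namespace IsProfile

omit hA

variable {v w : ℝ → ℝ} (hv : IsProfile v β ρ)
include hv

theorem comp_const_add (c : ℝ) : IsProfile (fun s => v (c + s)) β ρ := by
  have hderiv : deriv (fun s => v (c + s)) = fun s => deriv v (c + s) :=
    funext fun s => deriv_comp_const_add _ _ _
  refine ⟨fun s => hv.pos _, hv.differentiable.comp (differentiable_id.const_add c), fun s => ?_,
    fun s => ?_⟩
  · rw [hderiv]
    exact (hv.hasDerivAt_deriv (c + s)).comp_const_add c s
  · rw [hderiv]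
    exact hv.energy (c + s)

theorem eq_of_apply_eq (hw : IsProfile w β ρ) {t : ℝ} (h : v t = w t) (h' : deriv v t = deriv w t) :
    v = w := by
  funext s
  refine sub_eq_zero.mp (eq_zero_of_hasDerivAt_smul (e := fun s => v s - w s)
    (q := fun s => deriv v s - deriv w s) (b := fun s => 4 * β - 12 * (v s + w s))
    (continuous_const.sub (continuous_const.mul
      (hv.differentiable.continuous.add hw.differentiable.continuous)))
    (fun s => (hv.differentiable s).hasDerivAt.sub (hw.differentiable s).hasDerivAt)
    (fun s => ((hv.hasDerivAt_deriv s).sub (hw.hasDerivAt_deriv s)).congr_deriv ?_)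
    (sub_eq_zero.mpr h) (sub_eq_zero.mpr h') s)
  rw [smul_eq_mul]
  ring

theorem exists_isRootTriple (hρ : ρ ≠ 0) {y : ℝ} (hy : deriv v y ≠ 0) :
    ∃ A₁ A₂ A₃, IsRootTriple β ρ A₁ A₂ A₃ := by
  refine MinLag.exists_isRootTriple hρ (hv.pos y) ?_
  have : 0 < deriv v y ^ 2 := by positivity
  linarith [hv.energy y]

theorem deriv_sq_eq (hA : IsRootTriple β ρ A₁ A₂ A₃) (y : ℝ) :
    deriv v y ^ 2 = 8 * (A₁ - v y) * (v y - A₂) * (v y + A₃) := by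
  linear_combination 4 * hv.energy y + 4 * v y ^ 2 * hA.sum_eq - 4 * hA.prod_eq
    + 8 * v y * hA.mul_eq

theorem mem_Icc (hA : IsRootTriple β ρ A₁ A₂ A₃) (y : ℝ) : v y ∈ Set.Icc A₂ A₁ := by
  have h := hv.deriv_sq_eq hA y ▸ sq_nonneg (deriv v y)
  have h₃ : 0 < v y + A₃ := add_pos (hv.pos y) hA.pos₃
  have h₁₂ : 0 ≤ (A₁ - v y) * (v y - A₂) := by
    have := nonneg_of_mul_nonneg_left h h₃
    linarith
  have := hA.lt
  constructor <;> nlinarith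

theorem exists_eq_jacobiProfile (hA : IsRootTriple β ρ A₁ A₂ A₃) :
    ∃ y₀, ∀ s, v (y₀ + s) = jacobiProfile hA s := by
  have hw := isProfile_jacobiProfile hA
  obtain ⟨t, ht, ht'⟩ : ∃ t, jacobiProfile hA t = v 0 ∧ deriv (jacobiProfile hA) t = deriv v 0 := by
    obtain ⟨t, ht⟩ := exists_jacobiProfile_eq hA (hv.mem_Icc hA 0).1 (hv.mem_Icc hA 0).2
    have hsq : deriv (jacobiProfile hA) t ^ 2 = deriv v 0 ^ 2 := by
      rw [hw.deriv_sq_eq hA, hv.deriv_sq_eq hA, ht]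
    rcases sq_eq_sq_iff_eq_or_eq_neg.mp hsq with h | h
    · exact ⟨t, ht, h⟩
    · have hneg : (fun s => jacobiProfile hA (-s)) = jacobiProfile hA :=
        funext (jacobiProfile_neg hA)
      refine ⟨-t, (jacobiProfile_neg hA t).trans ht, ?_⟩
      rw [← neg_eq_iff_eq_neg.mpr h, ← neg_eq_iff_eq_neg, ← deriv_comp_neg, hneg]
  have hshift : v = fun s => jacobiProfile hA (t + s) := by
    refine hv.eq_of_apply_eq (hw.comp_const_add t) (t := 0) (by rw [add_zero, ht]) ?_
    rw [deriv_comp_const_add, add_zero, ht']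
  exact ⟨-t, fun s => by simp only [hshift, add_neg_cancel_left]⟩

theorem exists_isOscillation (hA : IsRootTriple β ρ A₁ A₂ A₃) :
    ∃ y₀, IsOscillation v A₁ A₂ (jacobiHalfPeriod A₁ A₂ A₃) y₀ := by
  obtain ⟨y₀, hy₀⟩ := hv.exists_eq_jacobiProfile hA
  obtain ⟨hmax, hmin, -, hsymm, hsymm', hint⟩ := isOscillation_jacobiProfile hA
  simp only [zero_add, zero_sub] at hmin hsymm hsymm' hint
  refine ⟨y₀, ?_, ?_, fun y => (hv.mem_Icc hA y).2, fun s => ?_, fun s => ?_, fun s hs => ?_⟩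
  · rw [← add_zero y₀, hy₀, hmax]
  · rw [hy₀, hmin]
  · rw [sub_eq_add_neg, hy₀, hy₀, hsymm]
  · rw [add_assoc, add_sub_assoc, hy₀, hy₀, hsymm']
  · exact hint s (by rwa [hy₀] at hs)

end IsProfile

end Profile

section EigenSolutions

variable {E : Type*} [NormedAddCommGroup E] [NormedSpace ℂ E] {v : ℝ → ℝ} {β ρ : ℝ} {G H : ℂ → E}

theorem hasDerivAt_im_smul {A : ℂ → E} (hA : Differentiable ℝ A) (c : ℝ → ℂ) (z : ℂ) :
    HasDerivAt (fun s : ℝ => c (z + s • (1 : ℂ)).im • A (z + s • (1 : ℂ)))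
      (c z.im • dirDeriv 1 A z) 0 := by
  have him (s : ℝ) : (z + s • (1 : ℂ)).im = z.im := by simp
  simp only [him]
  simpa using! (hasDerivAt_line hA 1 z 0).fun_const_smul (c z.im)

namespace StructureEquations

theorem differentiable (h : StructureEquations v ρ G) : Differentiable ℝ G :=
  h.smooth.differentiable (by simp)

theorem add (hG : StructureEquations v ρ G) (hH : StructureEquations v ρ H) :
    StructureEquations v ρ fun z => G z + H z := by
  have first (w : ℂ) :
      dirDeriv w (fun z => G z + H z) = fun z => dirDeriv w G z + dirDeriv w H z :=
    funext (dirDeriv_add hG.differentiable hH.differentiable w)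
  have second (w w' : ℂ) : dirDeriv w (fun z => dirDeriv w' G z + dirDeriv w' H z) =
      fun z => dirDeriv w (dirDeriv w' G) z + dirDeriv w (dirDeriv w' H) z :=
    funext (dirDeriv_add ((contDiff_dirDeriv hG.smooth w').differentiable (by simp))
      ((contDiff_dirDeriv hH.smooth w').differentiable (by simp)) w)
  refine ⟨hG.smooth.add hH.smooth, fun z => ?_, fun z => ?_, fun z => ?_⟩
  · rw [first, first, second]
    linear_combination (norm := module) hG.xx z + hH.xx z
  · rw [first, first, second]
    linear_combination (norm := module) hG.xy z + hH.xy z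
  · rw [first, first, second, second]
    linear_combination (norm := module) hG.laplace z + hH.laplace z

theorem const_smul (hG : StructureEquations v ρ G) (c : ℂ) :
    StructureEquations v ρ fun z => c • G z := by
  have first (w : ℂ) : dirDeriv w (fun z => c • G z) = fun z => c • dirDeriv w G z :=
    funext (dirDeriv_const_smul hG.differentiable c w)
  have second (w w' : ℂ) :
      dirDeriv w (fun z => c • dirDeriv w' G z) = fun z => c • dirDeriv w (dirDeriv w' G) z :=
    funext (dirDeriv_const_smul ((contDiff_dirDeriv hG.smooth w').differentiable (by simp)) c w)
  refine ⟨contDiff_const.smul hG.smooth, fun z => ?_, fun z => ?_, fun z => ?_⟩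
  · rw [first, first, second]
    linear_combination (norm := module) c • hG.xx z
  · rw [first, first, second]
    linear_combination (norm := module) c • hG.xy z
  · rw [first, first, second, second]
    linear_combination (norm := module) c • hG.laplace z

theorem dirDeriv_one (h : StructureEquations v ρ G) : StructureEquations v ρ (dirDeriv 1 G) := by
  have smooth₁ (w : ℂ) : ContDiff ℝ ∞ (dirDeriv w G) := contDiff_dirDeriv h.smooth w
  have diff₁ (w : ℂ) : Differentiable ℝ (dirDeriv w G) := (smooth₁ w).differentiable (by simp)
  have diff₂ (w w' : ℂ) : Differentiable ℝ (dirDeriv w (dirDeriv w' G)) :=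
    (contDiff_dirDeriv (smooth₁ w') w).differentiable (by simp)
  have comm₁ : dirDeriv I (dirDeriv 1 G) = dirDeriv 1 (dirDeriv I G) := dirDeriv_comm h.smooth _ _
  have comm₂ : dirDeriv I (dirDeriv 1 (dirDeriv I G)) = dirDeriv 1 (dirDeriv I (dirDeriv I G)) :=
    dirDeriv_comm (smooth₁ I) _ _
  refine ⟨smooth₁ 1, fun z => ?_, fun z => ?_, fun z => ?_⟩
  · rw [comm₁]
    have lhs := hasDerivAt_im_smul (diff₂ 1 1) (fun y => (v y : ℂ)) z
    have rhs := ((hasDerivAt_im_smul (diff₁ I) (fun y => (-(deriv v y / 2) : ℂ)) z).add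
      (hasDerivAt_im_smul (diff₁ 1) (fun _ => -(I * ρ)) z)).add
      (hasDerivAt_im_smul h.differentiable (fun y => -(2 * (v y : ℂ) ^ 2)) z)
    exact lhs.unique (rhs.congr_of_eventuallyEq (.of_forall fun s => h.xx _))
  · rw [comm₁]
    have lhs := hasDerivAt_im_smul (diff₂ 1 I) (fun y => (v y : ℂ)) z
    have rhs := (hasDerivAt_im_smul (diff₁ 1) (fun y => (deriv v y / 2 : ℂ)) z).add
      (hasDerivAt_im_smul (diff₁ I) (fun _ => I * ρ) z)
    exact lhs.unique (rhs.congr_of_eventuallyEq (.of_forall fun s => h.xy _))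
  · rw [comm₁, comm₂]
    have lhs := hasDerivAt_im_smul (diff₂ I I) (fun _ => 1) z
    have rhs := (hasDerivAt_im_smul h.differentiable (fun y => -(4 * v y : ℂ)) z).sub
      (hasDerivAt_im_smul (diff₂ 1 1) (fun _ => 1) z)
    simp only [one_smul] at lhs rhs
    exact lhs.unique (rhs.congr_of_eventuallyEq (.of_forall fun s => h.laplace _))

theorem cubic (h : StructureEquations v ρ G) (hv : IsProfile v β ρ) (z : ℂ) :
    dirDeriv 1 (dirDeriv 1 (dirDeriv 1 G)) z = (-(β : ℂ)) • dirDeriv 1 G z + (2 * I * ρ) • G z := by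
  have xxx := h.dirDeriv_one.xx z
  rw [dirDeriv_comm h.smooth I 1] at xxx
  have hne : (v z.im : ℂ) ^ 2 ≠ 0 := pow_ne_zero 2 (ofReal_ne_zero.mpr (hv.pos z.im).ne')
  have energy : ((deriv v z.im : ℝ) : ℂ) ^ 2 / 4 + (ρ : ℂ) ^ 2 + 2 * (v z.im : ℂ) ^ 3 =
      β * (v z.im : ℂ) ^ 2 := mod_cast congrArg ((↑) : ℝ → ℂ) (hv.energy z.im)
  apply smul_right_injective E hne
  linear_combination (norm := skip) (v z.im : ℂ) • xxx - (deriv v z.im / 2 : ℂ) • h.xy z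
    - (I * ρ) • h.xx z
  match_scalars
  · ring
  · ring
  · ring
  · linear_combination -energy + (ρ : ℂ) ^ 2 * I_sq
  · ring
  · ring

end StructureEquations

/-- A solution of the structure equations on which `∂ₓ` acts as the scalar `iδ`. -/
structure IsEigenSolution (v : ℝ → ℝ) (ρ δ : ℝ) (G : ℂ → E) : Prop
    extends StructureEquations v ρ G where
  dirDeriv_one_eq : ∀ z, dirDeriv 1 G z = (I * δ) • G z

namespace IsEigenSolution

variable {δ : ℝ} (h : IsEigenSolution v ρ δ G)
include h

theorem dirDeriv_one_dirDeriv_I (z : ℂ) :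
    dirDeriv 1 (dirDeriv I G) z = (I * δ) • dirDeriv I G z := by
  rw [dirDeriv_comm h.smooth, funext h.dirDeriv_one_eq, dirDeriv_const_smul h.differentiable]

theorem dirDeriv_one_dirDeriv_one (z : ℂ) :
    dirDeriv 1 (dirDeriv 1 G) z = (-(δ : ℂ) ^ 2) • G z := by
  rw [funext h.dirDeriv_one_eq, dirDeriv_const_smul h.differentiable, h.dirDeriv_one_eq, smul_smul]
  congr 1
  linear_combination (δ : ℂ) ^ 2 * I_sq

theorem deriv_smul_dirDeriv_I (z : ℂ) : (deriv v z.im / 2 : ℂ) • dirDeriv I G z =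
    ((v z.im * δ ^ 2 + ρ * δ - 2 * v z.im ^ 2 : ℝ) : ℂ) • G z := by
  have hxx := h.xx z
  rw [h.dirDeriv_one_dirDeriv_one, h.dirDeriv_one_eq] at hxx
  push_cast
  linear_combination (norm := skip) hxx
  match_scalars
  · ring
  · linear_combination -(ρ * δ : ℂ) * I_sq

theorem sub_smul_dirDeriv_I (z : ℂ) :
    ((v z.im * δ - ρ : ℝ) : ℂ) • dirDeriv I G z = (deriv v z.im / 2 * δ : ℂ) • G z := by
  have hxy := h.xy z
  rw [h.dirDeriv_one_dirDeriv_I, h.dirDeriv_one_eq] at hxy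
  apply smul_right_injective E I_ne_zero
  push_cast
  linear_combination (norm := module) hxy

theorem dirDeriv_I_dirDeriv_I (z : ℂ) :
    dirDeriv I (dirDeriv I G) z = (δ ^ 2 - 4 * v z.im) • G z := by
  rw [h.laplace, h.dirDeriv_one_dirDeriv_one, ← sub_smul, ← Complex.coe_smul]
  congr 1
  push_cast
  ring

theorem hasDerivAt_mul_I (y : ℝ) :
    HasDerivAt (fun y : ℝ => G (y * I)) (dirDeriv I G (y * I)) y := by
  simpa using hasDerivAt_line h.differentiable I 0 y

theorem hasDerivAt_dirDeriv_I_mul_I (y : ℝ) :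
    HasDerivAt (fun y : ℝ => dirDeriv I G (y * I)) ((δ ^ 2 - 4 * v y) • G (y * I)) y := by
  have hline := hasDerivAt_line ((contDiff_dirDeriv h.smooth I).differentiable (by simp)) I 0 y
  rw [h.dirDeriv_I_dirDeriv_I] at hline
  simpa using hline

section Reflection

variable (hv : Continuous v) {c : ℝ} (hsymm : ∀ s, v (c + s) = v (c - s)) (hc : deriv v c = 0)
include hv hsymm hc

theorem apply_add_eq_apply_sub (hne : v c * δ ≠ ρ) (s : ℝ) :
    G ((c + s : ℝ) * I) = G ((c - s : ℝ) * I) := by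
  refine even_of_deriv_eq_zero (b := fun y => δ ^ 2 - 4 * v y) (by fun_prop)
    h.hasDerivAt_mul_I h.hasDerivAt_dirDeriv_I_mul_I (fun s => by rw [hsymm]) ?_ s
  have hcrit := h.sub_smul_dirDeriv_I (c * I)
  simp only [mul_I_im, ofReal_re, hc, ofReal_zero, zero_div, zero_mul, zero_smul] at hcrit
  exact (smul_eq_zero.mp hcrit).resolve_left (ofReal_ne_zero.mpr (sub_ne_zero.mpr hne))

theorem apply_add_eq_neg_apply_sub (hne : v c * δ ^ 2 + ρ * δ - 2 * v c ^ 2 ≠ 0) (s : ℝ) :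
    G ((c + s : ℝ) * I) = -G ((c - s : ℝ) * I) := by
  refine odd_of_eq_zero (b := fun y => δ ^ 2 - 4 * v y) (by fun_prop)
    h.hasDerivAt_mul_I h.hasDerivAt_dirDeriv_I_mul_I (fun s => by rw [hsymm]) ?_ s
  have hcrit := h.deriv_smul_dirDeriv_I (c * I)
  simp only [mul_I_im, ofReal_re, hc, ofReal_zero, zero_div, zero_smul] at hcrit
  exact (smul_eq_zero.mp hcrit.symm).resolve_left (ofReal_ne_zero.mpr hne)

end Reflection

theorem apply_add_ofReal (z : ℂ) (x : ℝ) : G (z + x) = cexp (I * δ * x) • G z := by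
  have hexp (s : ℝ) : HasDerivAt (fun s : ℝ => cexp (-(I * δ * s)))
      (cexp (-(I * δ * s)) * -(I * δ)) s := by
    simpa using! (((ofRealCLM.hasDerivAt (x := s)).const_mul (I * δ)).fun_neg).cexp
  have hconst (s : ℝ) :
      HasDerivAt (fun s : ℝ => cexp (-(I * δ * s)) • G (z + s • (1 : ℂ))) 0 s := by
    refine ((hexp s).smul (hasDerivAt_line h.differentiable 1 z s)).congr_deriv ?_
    rw [h.dirDeriv_one_eq]
    module
  have heq := is_const_of_deriv_eq_zero (fun s => (hconst s).differentiableAt)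
    (fun s => (hconst s).deriv) x 0
  simp only [real_smul, mul_one, ofReal_zero, mul_zero, neg_zero, Complex.exp_zero, one_smul,
    add_zero] at heq
  rw [← heq, smul_smul, ← Complex.exp_add, add_neg_cancel, Complex.exp_zero, one_smul]

/-- Two reflections of signs `a` and `b` compose to a translation of sign `a b`. -/
theorem apply_add_two_mul_I {y₀ T : ℝ} {a b : ℂ}
    (ha : ∀ s : ℝ, G ((y₀ + s : ℝ) * I) = a • G ((y₀ - s : ℝ) * I))
    (hb : ∀ s : ℝ, G ((y₀ + T + s : ℝ) * I) = b • G ((y₀ + T - s : ℝ) * I)) (z : ℂ) :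
    G (z + 2 * T * I) = (a * b) • G z := by
  have himag (y : ℝ) : G ((y + 2 * T : ℝ) * I) = (a * b) • G (y * I) := by
    have hfar := hb (y - y₀ + T)
    have hnear := ha (y₀ - y)
    rw [show y₀ + (y₀ - y) = y₀ + T - (y - y₀ + T) by ring, sub_sub_cancel] at hnear
    rw [hnear, smul_smul, mul_comm b] at hfar
    convert hfar using 4
    ring
  have hz : z + 2 * T * I = (z.im + 2 * T : ℝ) * I + z.re := by
    push_cast
    linear_combination -(re_add_im z)
  have hz' : G z = cexp (I * δ * z.re) • G (z.im * I) := by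
    rw [← h.apply_add_ofReal, add_comm, re_add_im]
  rw [hz, h.apply_add_ofReal, himag, hz', smul_comm]

end IsEigenSolution

/-- The numbers `i δ_j` are the distinct roots of `X³ + βX - 2iρ`, the polynomial that annihilates
`∂ₓ` on the solutions of the structure equations. -/
structure IsFrequencyTriple (β ρ : ℝ) (δ : Fin 3 → ℝ) : Prop where
  injective : Function.Injective δ
  sum_eq : δ 0 + δ 1 + δ 2 = 0
  pairs_eq : δ 0 * δ 1 + δ 0 * δ 2 + δ 1 * δ 2 = -β
  prod_eq : δ 0 * δ 1 * δ 2 = -(2 * ρ)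

/-- The `iδ_j`-component of `G`: the Lagrange polynomial which is `1` at `iδ_j` and vanishes at the
other two points `iδ_{j+1}`, `iδ_{j+2}` (indices modulo 3), applied to `∂ₓ`. -/
def eigenComponent (δ : Fin 3 → ℝ) (j : Fin 3) (G : ℂ → E) (z : ℂ) : E :=
  (-((δ j - δ (j + 1)) * (δ j - δ (j + 2)) : ℂ)⁻¹) •
    (dirDeriv 1 (dirDeriv 1 G) z + (-(I * (δ (j + 1) + δ (j + 2)))) • dirDeriv 1 G z +
      (-(δ (j + 1) * δ (j + 2) : ℂ)) • G z)

section EigenComponent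

variable {δ : Fin 3 → ℝ}

theorem sum_eigenComponent (hδ : Function.Injective δ) (G : ℂ → E) (z : ℂ) :
    ∑ j, eigenComponent δ j G z = G z := by
  have hne {i j : Fin 3} (hij : i ≠ j) : (δ i - δ j : ℂ) ≠ 0 :=
    sub_ne_zero.mpr (ofReal_injective.ne (hδ.ne hij))
  have h01 := hne (i := 0) (j := 1) (by decide)
  have h02 := hne (i := 0) (j := 2) (by decide)
  have h12 := hne (i := 1) (j := 2) (by decide)
  simp only [Fin.sum_univ_three, eigenComponent, Fin.reduceAdd, ← neg_sub (δ 0 : ℂ) (δ 1),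
    ← neg_sub (δ 0 : ℂ) (δ 2), ← neg_sub (δ 1 : ℂ) (δ 2)]
  match_scalars <;> field_simp <;> ring

theorem eigenComponent_add_of_apply_add (hG : ContDiff ℝ ∞ G) {τ c : ℂ}
    (hc : ∀ z, G (z + τ) = c • G z) (j : Fin 3) (z : ℂ) :
    eigenComponent δ j G (z + τ) = c • eigenComponent δ j G z := by
  have dirDeriv_add_eq {A : ℂ → E} (hA : ContDiff ℝ ∞ A) (hcA : ∀ z, A (z + τ) = c • A z) (z : ℂ) :
      dirDeriv 1 A (z + τ) = c • dirDeriv 1 A z := by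
    rw [← dirDeriv_const_smul (hA.differentiable (by simp)), ← funext hcA, dirDeriv_comp_add_right]
  have first := dirDeriv_add_eq hG hc
  rw [eigenComponent, eigenComponent, dirDeriv_add_eq (contDiff_dirDeriv hG 1) first, first, hc]
  module

theorem StructureEquations.isEigenSolution_eigenComponent (hG : StructureEquations v ρ G)
    (hv : IsProfile v β ρ) (hδ : IsFrequencyTriple β ρ δ) (j : Fin 3) :
    IsEigenSolution v ρ (δ j) (eigenComponent δ j G) where
  toStructureEquations := ((hG.dirDeriv_one.dirDeriv_one.add (hG.dirDeriv_one.const_smul _)).add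
    (hG.const_smul _)).const_smul _
  dirDeriv_one_eq z := by
    have diff₀ (c : ℂ) := (hG.const_smul c).differentiable
    have diff₁ (c : ℂ) := (hG.dirDeriv_one.const_smul c).differentiable
    have diff₂ := hG.dirDeriv_one.dirDeriv_one.differentiable
    obtain ⟨sum_eq, pairs_eq, prod_eq⟩ : (δ j + δ (j + 1) + δ (j + 2) : ℂ) = 0 ∧
        (δ j * δ (j + 1) + δ j * δ (j + 2) + δ (j + 1) * δ (j + 2) : ℂ) = -β ∧
        (δ j * δ (j + 1) * δ (j + 2) : ℂ) = -(2 * ρ) := by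
      obtain ⟨-, h₁, h₂, h₃⟩ := hδ
      norm_cast
      fin_cases j <;> exact ⟨by grind, by grind, by grind⟩
    simp only [funext (eigenComponent.eq_1 δ j G)]
    rw [dirDeriv_const_smul ((diff₂.fun_add (diff₁ _)).fun_add (diff₀ _)),
      dirDeriv_add (diff₂.fun_add (diff₁ _)) (diff₀ _), dirDeriv_add diff₂ (diff₁ _),
      dirDeriv_const_smul hG.dirDeriv_one.differentiable, dirDeriv_const_smul hG.differentiable,
      hG.cubic hv, smul_comm (I * _ : ℂ)]
    congr 1
    match_scalars
    · linear_combination -pairs_eq + (δ j * (δ (j + 1) + δ (j + 2)) : ℂ) * I_sq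
    · linear_combination I * prod_eq
    · linear_combination -I * sum_eq

end EigenComponent

namespace IsEigenSolution

theorem apply_add_zpow {δ T : ℝ} {s : ℂ} (h : IsEigenSolution v ρ δ G) (hs : s ≠ 0)
    (hT : ∀ z, G (z + 2 * T * I) = s • G z) {τ : ℂ} {m : ℤ} (hτ : τ.im = m * (2 * T)) (z : ℂ) :
    G (z + τ) = (cexp (I * δ * τ.re) * s ^ m) • G z := by
  have himag (m : ℤ) (z : ℂ) : G (z + m * (2 * T * I)) = s ^ m • G z := by
    induction m using Int.induction_on with
    | zero => simp
    | succ i ih =>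
      push_cast at ih ⊢
      rw [add_one_mul, ← add_assoc, hT, ih, smul_smul, zpow_add_one₀ hs, mul_comm]
    | pred i ih =>
      push_cast at ih ⊢
      have hprev := hT (z + (-i - 1) * (2 * T * I))
      rw [show z + (-i - 1) * (2 * T * I) + 2 * T * I = z + -i * (2 * T * I) by ring, ih] at hprev
      rw [zpow_sub_one₀ hs, mul_comm (s ^ _), mul_smul, hprev, inv_smul_smul₀ hs]
  have hsplit : z + τ = z + m * (2 * T * I) + τ.re := by
    conv_lhs => rw [← re_add_im τ, hτ]
    push_cast
    ring
  rw [hsplit, h.apply_add_ofReal, himag, smul_smul]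

end IsEigenSolution

end EigenSolutions

section Frequencies

/-- The roots of `w³ - (β/2) w² + ρ²/2`. -/
def cubicRoots (A₁ A₂ A₃ : ℝ) : Fin 3 → ℝ := ![A₁, A₂, -A₃]

/-- The numbers `δ_j = ρ / w_j`, where `w` runs through the roots of `w³ - (β/2) w² + ρ²/2`. -/
def frequencies (ρ A₁ A₂ A₃ : ℝ) (j : Fin 3) : ℝ := ρ / cubicRoots A₁ A₂ A₃ j

/-- The factor by which the `iδ_j`-component of a solution is multiplied under translation by
`2Ti`. -/
def translationSign : Fin 3 → ℂ := ![-1, -1, 1]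

theorem translationSign_ne_zero (j : Fin 3) : translationSign j ≠ 0 := by
  fin_cases j <;> simp [translationSign]

namespace IsRootTriple

variable {β ρ A₁ A₂ A₃ : ℝ} (hA : IsRootTriple β ρ A₁ A₂ A₃)
include hA

theorem two_mul_lt_sq : 2 * (A₂ * A₃) < A₁ ^ 2 := by
  have hlt := sub_pos.mpr hA.lt
  linarith [hA.mul_eq, mul_pos hA.pos₁ hlt, mul_pos hA.pos₃ hlt]

theorem sq_lt_two_mul : A₂ ^ 2 < 2 * (A₁ * A₃) := by
  have hlt := sub_pos.mpr hA.lt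
  linarith [hA.mul_eq, mul_pos hA.pos₂ hlt, mul_pos hA.pos₃ hlt]

theorem injective_cubicRoots : Function.Injective (cubicRoots A₁ A₂ A₃) := by
  have h₂₃ : -A₃ < A₂ := (neg_neg_of_pos hA.pos₃).trans hA.pos₂
  refine StrictAnti.injective (Fin.strictAnti_iff_succ_lt.mpr fun i => ?_)
  fin_cases i
  · exact hA.lt
  · exact h₂₃

theorem cubicRoots_ne_zero (j : Fin 3) : cubicRoots A₁ A₂ A₃ j ≠ 0 := by
  fin_cases j
  · exact hA.pos₁.ne'
  · exact hA.pos₂.ne'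
  · exact neg_ne_zero.mpr hA.pos₃.ne'

theorem cubicRoots_pow_ne (j : Fin 3) : cubicRoots A₁ A₂ A₃ j ^ 3 ≠ ρ ^ 2 := by
  rw [hA.prod_eq]
  fin_cases j <;> simp only [cubicRoots, Fin.reduceFinMk, Matrix.cons_val]
  · nlinarith [mul_lt_mul_of_pos_left hA.two_mul_lt_sq hA.pos₁]
  · nlinarith [mul_lt_mul_of_pos_left hA.sq_lt_two_mul hA.pos₂]
  · nlinarith [mul_pos (mul_pos hA.pos₁ hA.pos₂) hA.pos₃, pow_pos hA.pos₃ 3]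

theorem isFrequencyTriple (hρ : ρ ≠ 0) : IsFrequencyTriple β ρ (frequencies ρ A₁ A₂ A₃) := by
  have h₁ := hA.pos₁.ne'
  have h₂ := hA.pos₂.ne'
  have h₃ := hA.pos₃.ne'
  refine ⟨fun i j hij => hA.injective_cubicRoots (inv_injective (mul_left_cancel₀ hρ hij)),
    ?_, ?_, ?_⟩ <;> simp only [frequencies, cubicRoots, Matrix.cons_val]
  · field_simp
    linear_combination -ρ * hA.mul_eq
  · rw [hA.sum_eq]
    field_simp
    rw [hA.prod_eq]
    ring
  · field_simp
    rw [hA.prod_eq]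
    ring

end IsRootTriple

namespace IsEigenSolution

variable {E : Type*} [NormedAddCommGroup E] [NormedSpace ℂ E] {v : ℝ → ℝ} {G : ℂ → E}
  {β ρ A₁ A₂ A₃ : ℝ} {j : Fin 3} (h : IsEigenSolution v ρ (frequencies ρ A₁ A₂ A₃ j) G)
include h

theorem apply_add_eq_ite_smul (hρ : ρ ≠ 0) (hA : IsRootTriple β ρ A₁ A₂ A₃)
    (hv : IsProfile v β ρ) {c : ℝ} {k : Fin 3} (hc : v c = cubicRoots A₁ A₂ A₃ k)
    (hc' : deriv v c = 0) (hsymm : ∀ s, v (c + s) = v (c - s)) (s : ℝ) :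
    G ((c + s : ℝ) * I) = (if j = k then -1 else 1 : ℂ) • G ((c - s : ℝ) * I) := by
  have hw := hA.cubicRoots_ne_zero j
  split_ifs with hjk
  · subst hjk
    rw [neg_one_smul]
    refine h.apply_add_eq_neg_apply_sub hv.differentiable.continuous hsymm hc' ?_ s
    intro h₀
    refine hA.cubicRoots_pow_ne j ?_
    rw [hc, frequencies] at h₀
    field_simp at h₀
    linarith
  · rw [one_smul]
    refine h.apply_add_eq_apply_sub hv.differentiable.continuous hsymm hc' ?_ s
    intro h₀
    rw [hc, frequencies, mul_div_left_comm, mul_eq_left₀ hρ, div_eq_one_iff_eq hw] at h₀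
    exact hjk (hA.injective_cubicRoots h₀).symm

theorem apply_add_two_halfPeriods (hρ : ρ ≠ 0) (hA : IsRootTriple β ρ A₁ A₂ A₃)
    (hv : IsProfile v β ρ) {T y₀ : ℝ} (hosc : IsOscillation v A₁ A₂ T y₀) (z : ℂ) :
    G (z + 2 * T * I) = translationSign j • G z := by
  have critical {y : ℝ} (hy : v y = A₁ ∨ v y = A₂) : deriv v y = 0 := by
    rw [← sq_eq_zero_iff, hv.deriv_sq_eq hA]
    rcases hy with hy | hy <;> rw [hy] <;> ring
  have at_max := h.apply_add_eq_ite_smul hρ hA hv (k := 0) hosc.apply_max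
    (critical (.inl hosc.apply_max)) hosc.symm_max
  have at_min := h.apply_add_eq_ite_smul hρ hA hv (k := 1) hosc.apply_min
    (critical (.inr hosc.apply_min)) hosc.symm_min
  have hsign : (if j = 0 then -1 else 1 : ℂ) * (if j = 1 then -1 else 1) = translationSign j := by
    fin_cases j <;> simp [translationSign]
  rw [← hsign]
  exact h.apply_add_two_mul_I at_max at_min z

end IsEigenSolution

end Frequencies

section PeriodLattice

/-- `τ` is a translation under which the three `iδ_j`-components of a lift are multiplied by the
same factor. -/
def IsPhasePeriod (δ : Fin 3 → ℝ) (T : ℝ) (τ : ℂ) : Prop :=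
  ∃ m : ℤ, τ.im = m * (2 * T) ∧ ∃ c : ℂ, ∀ j, cexp (I * δ j * τ.re) * translationSign j ^ m = c

theorem a₁_eq_of_le {F : ℂ → C3} {A : ℝ} {z₀ : ℂ} (hle : ∀ z, expU F z ≤ A)
    (h₀ : expU F z₀ = A) : a₁ F = A :=
  le_antisymm (ciSup_le hle) (h₀ ▸ le_ciSup ⟨A, Set.forall_mem_range.mpr hle⟩ z₀)

namespace IsMinimalLagrangianLift

variable {F : ℂ → C3} {f : ℂ → CP2} (hF : IsMinimalLagrangianLift F f)
include hF

theorem coeff_eq_zero_of_smul_add_eq_zero {z a b c : ℂ}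
    (h : a • dz F z + b • dzbar F z + c • F z = 0) : a = 0 ∧ b = 0 := by
  have h₀₁ : ⟪dz F z, dzbar F z⟫ = 0 := hF.orthogonal_frame z (i := 0) (j := 1) (by decide)
  have h₁₀ : ⟪dzbar F z, dz F z⟫ = 0 := hF.orthogonal_frame z (i := 1) (j := 0) (by decide)
  have h₂₀ : ⟪F z, dz F z⟫ = 0 := hF.orthogonal_frame z (i := 2) (j := 0) (by decide)
  have h₂₁ : ⟪F z, dzbar F z⟫ = 0 := hF.orthogonal_frame z (i := 2) (j := 1) (by decide)
  have ha := congrArg (fun A : C3 => ⟪A, dz F z⟫) h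
  have hb := congrArg (fun A : C3 => ⟪A, dzbar F z⟫) h
  simp only [add_dotProduct, smul_dotProduct, h₀₁, h₁₀, h₂₀, h₂₁, hF.conformal_dz,
    hF.conformal_dzbar, zero_dotProduct, smul_eq_mul, mul_zero, add_zero, zero_add, mul_eq_zero,
    hF.expU_ne_zero, or_false] at ha hb
  exact ⟨ha, hb⟩

variable {v : ℝ → ℝ} {β ρ : ℝ}

theorem eigenComponent_ne_zero (hS : StructureEquations v ρ F) {y : ℝ} (hy : deriv v y ≠ 0)
    {δ : Fin 3 → ℝ} (hδ : Function.Injective δ) (j : Fin 3) :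
    eigenComponent δ j F (y * I) ≠ 0 := by
  have hne {i : Fin 3} (hij : j ≠ i) : (δ j - δ i : ℂ) ≠ 0 :=
    sub_ne_zero.mpr (ofReal_injective.ne (hδ.ne hij))
  intro h₀
  rw [eigenComponent, smul_eq_zero_iff_right (neg_ne_zero.mpr (inv_ne_zero (mul_ne_zero
    (hne (by fin_cases j <;> decide)) (hne (by fin_cases j <;> decide)))))] at h₀
  have hxx := hS.xx (y * I)
  rw [mul_I_im, ofReal_re, dirDeriv_I_eq, dirDeriv_one_eq F, wirtinger_eq_dz, wirtingerBar_eq_dzbar]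
    at hxx
  rw [dirDeriv_one_eq F, wirtinger_eq_dz, wirtingerBar_eq_dzbar] at h₀
  obtain ⟨ha, hb⟩ := hF.coeff_eq_zero_of_smul_add_eq_zero (z := y * I)
    (a := -(I * ρ) - v y * (I * (δ (j + 1) + δ (j + 2))) - deriv v y / 2 * I)
    (b := -(I * ρ) - v y * (I * (δ (j + 1) + δ (j + 2))) + deriv v y / 2 * I)
    (c := -(2 * (v y : ℂ) ^ 2) - v y * (δ (j + 1) * δ (j + 2)))
    (by linear_combination (norm := module) (v y : ℂ) • h₀ - hxx)
  have hcoeff : ((deriv v y : ℝ) : ℂ) * I = 0 := by linear_combination hb - ha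
  exact hy (ofReal_eq_zero.mp ((mul_eq_zero.mp hcoeff).resolve_right I_ne_zero))

/-- A period preserves `e^u`, hence takes maxima to maxima, so its imaginary part is a multiple of
`2T`. -/
theorem mem_periodLattice_iff_isPhasePeriod (hv : ∀ z, expU F z = v z.im)
    (hS : StructureEquations v ρ F) (hp : IsProfile v β ρ) (hρ : ρ ≠ 0) {A₁ A₂ A₃ T y₀ y₁ : ℝ}
    (hA : IsRootTriple β ρ A₁ A₂ A₃) (hosc : IsOscillation v A₁ A₂ T y₀) (hy₁ : deriv v y₁ ≠ 0)
    (τ : ℂ) : τ ∈ periodLattice f ↔ IsPhasePeriod (frequencies ρ A₁ A₂ A₃) T τ := by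
  set δ := frequencies ρ A₁ A₂ A₃
  have hδ : IsFrequencyTriple β ρ δ := hA.isFrequencyTriple hρ
  have translate {m : ℤ} (hm : τ.im = m * (2 * T)) (j : Fin 3) (z : ℂ) :
      eigenComponent δ j F (z + τ) =
        (cexp (I * δ j * τ.re) * translationSign j ^ m) • eigenComponent δ j F z :=
    have hj := hS.isEigenSolution_eigenComponent hp hδ j
    hj.apply_add_zpow (translationSign_ne_zero j)
      (hj.apply_add_two_halfPeriods hρ hA hp hosc) hm z
  constructor
  · intro hτ
    obtain ⟨c, hc⟩ := (hF.mem_periodLattice_iff τ).mp hτ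
    have hmax : v (y₀ + τ.im) = A₁ := by
      simpa [hv, hosc.apply_max] using hF.expU_add_of_mem_periodLattice hτ (y₀ * I)
    obtain ⟨m, hm⟩ := hosc.exists_int τ.im hmax
    refine ⟨m, hm, c, fun j => ?_⟩
    refine smul_left_injective ℂ (hF.eigenComponent_ne_zero hS hy₁ hδ.injective j) ?_
    exact (translate hm j _).symm.trans (eigenComponent_add_of_apply_add hS.smooth hc j _)
  · rintro ⟨m, hm, c, hc⟩
    refine (hF.mem_periodLattice_iff τ).mpr ⟨c, fun z => ?_⟩
    rw [← sum_eigenComponent hδ.injective F (z + τ), ← sum_eigenComponent hδ.injective F z,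
      Finset.smul_sum]
    exact Finset.sum_congr rfl fun j _ => by rw [translate hm, hc]

theorem exists_frequencies (hv : ∀ z, expU F z = v z.im) (hhopf : ∀ z, hopf F z = -(I * ρ))
    (hp : IsProfile v β ρ) (hρ : ρ ≠ 0) (hnonflat : ∃ z w, metricU F z ≠ metricU F w) :
    ∃ δ, IsFrequencyTriple β ρ δ ∧ halfPeriod F ≠ 0 ∧
      ∀ τ, τ ∈ periodLattice f ↔ IsPhasePeriod δ (halfPeriod F) τ := by
  obtain ⟨y₁, hy₁⟩ : ∃ y, deriv v y ≠ 0 := by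
    by_contra! hzero
    obtain ⟨z, w, hzw⟩ := hnonflat
    refine hzw ?_
    rw [metricU, metricU, hv, hv, is_const_of_deriv_eq_zero hp.differentiable hzero z.im w.im]
  obtain ⟨A₁, A₂, A₃, hA⟩ := hp.exists_isRootTriple hρ hy₁
  obtain ⟨y₀, hosc⟩ := hp.exists_isOscillation hA
  have hmax : a₁ F = A₁ := a₁_eq_of_le (z₀ := y₀ * I) (fun z => hv z ▸ hosc.le_max z.im)
    (by simp [hv, hosc.apply_max])
  have hT : halfPeriod F = jacobiHalfPeriod A₁ A₂ A₃ := hA.halfPeriod_eq hmax (by simp [hhopf])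
  have hT₀ : jacobiHalfPeriod A₁ A₂ A₃ ≠ 0 := fun h => hA.lt.ne <| by
    rw [← hosc.apply_min, h, add_zero, hosc.apply_max]
  rw [hT]
  exact ⟨_, hA.isFrequencyTriple hρ, hT₀, hF.mem_periodLattice_iff_isPhasePeriod hv
    (hF.structureEquations hv hhopf) hp hρ hA hosc hy₁⟩

end IsMinimalLagrangianLift

end PeriodLattice

section Generator

/-- The frame `(F_z, F_z̄, F)`, as columns, before normalization by `λ` and `e^{-u/2}`. -/
def frame (F : ℂ → C3) (z : ℂ) : Matrix (Fin 3) (Fin 3) ℂ :=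
  (Matrix.of ![dz F z, dzbar F z, F z])ᵀ

/-- The factors by which the columns of `frame` are multiplied in `extendedFrame`. -/
def frameScale (F : ℂ → C3) (lam z : ℂ) : Fin 3 → ℂ :=
  ![-I * lam * (Real.exp (-(metricU F z) / 2) : ℂ),
    (I * lam)⁻¹ * (Real.exp (-(metricU F z) / 2) : ℂ), 1]

/-- The matrix `B` with `∂ₓ frame = frame * B`, in terms of `w = e^u`, `w' = ∂_y e^u` and the Hopf
coefficient `-iρ`. -/
def frameConnection (w w' ρ : ℂ) : Matrix (Fin 3) (Fin 3) ℂ :=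
  !![-(I * w' / (2 * w)), -(I * ρ / w), 1;
     -(I * ρ / w), I * w' / (2 * w), 1;
     -w, -w, 0]

theorem extendedFrame_eq_frame_mul (F : ℂ → C3) (lam z : ℂ) :
    extendedFrame F lam z = frame F z * Matrix.diagonal (frameScale F lam z) := by
  ext i j
  rw [Matrix.mul_diagonal]
  fin_cases j <;> simp [extendedFrame, frame, frameScale, mul_comm]

theorem isUnit_diagonal_frameScale (F : ℂ → C3) {lam : ℂ} (hlam : lam ≠ 0) (z : ℂ) :
    IsUnit (Matrix.diagonal (frameScale F lam z)) := by
  rw [Matrix.isUnit_diagonal, Pi.isUnit_iff]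
  intro i
  fin_cases i <;> simp [frameScale, hlam]

open Polynomial in
theorem charpoly_frameConnection {w w' ρ β : ℂ} (hw : w ≠ 0)
    (h : w' ^ 2 / 4 + ρ ^ 2 + 2 * w ^ 3 = β * w ^ 2) :
    (frameConnection w w' ρ).charpoly = X ^ 3 + C β * X - C (2 * I * ρ) := by
  set a := I * w' / (2 * w) with ha
  set b := I * ρ / w with hb
  have hβ : β = 2 * w - a ^ 2 - b ^ 2 := by
    rw [ha, hb]
    field_simp
    linear_combination -4 * h + (w' ^ 2 + 4 * ρ ^ 2) * I_sq
  have hρ : 2 * I * ρ = 2 * w * b := by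
    rw [hb]
    field_simp
  have hchar : (frameConnection w w' ρ).charmatrix =
      !![X + C a, C b, -1; C b, X - C a, -1; C w, C w, X] := by
    ext1 i j
    fin_cases i <;> fin_cases j <;> simp [frameConnection, ← ha, ← hb]
  rw [hβ, hρ, Matrix.charpoly, hchar, Matrix.det_fin_three]
  simp only [Matrix.of_apply, Matrix.cons_val, map_sub, map_mul, map_pow, map_ofNat]
  ring

open Polynomial in
theorem IsFrequencyTriple.prod_X_sub_C {β ρ : ℝ} {δ : Fin 3 → ℝ} (hδ : IsFrequencyTriple β ρ δ) :
    ∏ j, (X - C (I * δ j)) = X ^ 3 + C (β : ℂ) * X - C (2 * I * ρ) := by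
  have hsum : (δ 0 + δ 1 + δ 2 : ℂ) = 0 := by exact_mod_cast congrArg ofReal hδ.sum_eq
  have hpairs : (δ 0 * δ 1 + δ 0 * δ 2 + δ 1 * δ 2 : ℂ) = -β := by
    exact_mod_cast congrArg ofReal hδ.pairs_eq
  have hprod : (δ 0 * δ 1 * δ 2 : ℂ) = -(2 * ρ) := by exact_mod_cast congrArg ofReal hδ.prod_eq
  refine Polynomial.funext fun x => ?_
  simp only [Fin.prod_univ_three, eval_mul, eval_sub, eval_add, eval_pow, eval_X, eval_C]
  linear_combination -x ^ 2 * I * hsum - x * hpairs + I * hprod +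
    (x * (δ 0 * δ 1 + δ 0 * δ 2 + δ 1 * δ 2) - I * (δ 0 * δ 1 * δ 2)) * I_sq

namespace IsMinimalLagrangianLift

variable {F : ℂ → C3} {f : ℂ → CP2} (hF : IsMinimalLagrangianLift F f)
include hF

theorem isUnit_frame (z : ℂ) : IsUnit (frame F z) := by
  have hdet := isUnit_det_of_orthogonal (X := Matrix.of ![dz F z, dzbar F z, F z])
    (hF.orthogonal_frame z) (hF.dotProduct_frame_ne_zero z)
  rwa [frame, Matrix.isUnit_transpose, Matrix.isUnit_iff_isUnit_det]

variable {v : ℝ → ℝ} {β ρ : ℝ} (hv : ∀ z, expU F z = v z.im) (hρ : ∀ z, hopf F z = -(I * ρ))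
include hv hρ

theorem dirDeriv_one_dz (z : ℂ) : dirDeriv 1 (dz F) z =
    (-(I * (deriv v z.im : ℝ) / (2 * v z.im))) • dz F z + (-(I * ρ / v z.im)) • dzbar F z +
      (-(v z.im : ℂ)) • F z := by
  have hw : (v z.im : ℂ) ≠ 0 := hv z ▸ hF.expU_ne_zero z
  have hzz := hF.expU_smul_dz_dz z
  rw [hF.wirtinger_cexpU hv, hρ, hv] at hzz
  rw [dirDeriv_one_eq, wirtinger_eq_dz, wirtingerBar_eq_dzbar, hF.dzbar_dz, hv]
  refine smul_right_injective C3 hw ?_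
  simp only [smul_add, hzz]
  match_scalars <;> field_simp

theorem dirDeriv_one_dzbar (z : ℂ) : dirDeriv 1 (dzbar F) z =
    (-(I * ρ / v z.im)) • dz F z + (I * (deriv v z.im : ℝ) / (2 * v z.im)) • dzbar F z +
      (-(v z.im : ℂ)) • F z := by
  have hw : (v z.im : ℂ) ≠ 0 := hv z ▸ hF.expU_ne_zero z
  have hstar : star (-(I * ρ) : ℂ) = I * ρ := by simp
  have hzbzb := hF.expU_smul_dzbar_dzbar z
  rw [hF.wirtingerBar_cexpU hv, hρ, hv, hstar] at hzbzb
  rw [dirDeriv_one_eq, wirtinger_eq_dz, wirtingerBar_eq_dzbar, ← hF.dzbar_dz_eq_dz_dzbar,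
    hF.dzbar_dz, hv]
  refine smul_right_injective C3 hw ?_
  simp only [smul_add, hzbzb]
  match_scalars <;> field_simp

theorem hasDerivAt_frame (i j : Fin 3) :
    HasDerivAt (fun x : ℝ => frame F x i j)
      ((frame F 0 * frameConnection (v 0) (deriv v 0 : ℝ) ρ) i j) 0 := by
  have hline {G : ℂ → C3} (hG : Differentiable ℝ G) :
      HasDerivAt (fun x : ℝ => G x i) (dirDeriv 1 G 0 i) 0 := by
    simpa using hasDerivAt_pi.mp (hasDerivAt_line hG 1 0 0) i
  have hone : dirDeriv 1 F 0 = dz F 0 + dzbar F 0 := dirDeriv_one_eq F 0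
  have hdz := hline hF.differentiable_dz
  have hdzbar := hline hF.differentiable_dzbar
  have hself := hline hF.differentiable
  rw [hF.dirDeriv_one_dz hv hρ] at hdz
  rw [hF.dirDeriv_one_dzbar hv hρ] at hdzbar
  rw [hone] at hself
  rw [Matrix.mul_apply, Fin.sum_univ_three]
  fin_cases j
  · refine hdz.congr_deriv ?_
    simp [frame, frameConnection, mul_comm]
  · refine hdzbar.congr_deriv ?_
    simp [frame, frameConnection, mul_comm]
  · refine hself.congr_deriv ?_
    simp [frame, frameConnection]

theorem generator_eq (lam : ℂ) :
    generator F lam = (Matrix.diagonal (frameScale F lam 0))⁻¹ *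
      frameConnection (v 0) (deriv v 0 : ℝ) ρ * Matrix.diagonal (frameScale F lam 0) := by
  have hscale (x : ℝ) : frameScale F lam x = frameScale F lam 0 := by
    simp only [frameScale, metricU, hv, ofReal_im, zero_im]
  have hderiv : (Matrix.of fun i j => deriv (fun x : ℝ => extendedFrame F lam x i j) 0) =
      frame F 0 * frameConnection (v 0) (deriv v 0 : ℝ) ρ *
        Matrix.diagonal (frameScale F lam 0) := by
    ext i j
    simp only [Matrix.of_apply, extendedFrame_eq_frame_mul, Matrix.mul_diagonal, hscale]
    exact ((hF.hasDerivAt_frame hv hρ i j).mul_const _).deriv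
  have hcancel : (frame F 0)⁻¹ * frame F 0 = 1 :=
    Matrix.nonsing_inv_mul _ ((Matrix.isUnit_iff_isUnit_det _).mp (hF.isUnit_frame 0))
  rw [generator, hderiv, extendedFrame_eq_frame_mul, Matrix.mul_inv_rev, Matrix.mul_assoc,
    Matrix.mul_assoc, ← Matrix.mul_assoc (frame F 0)⁻¹, hcancel, Matrix.one_mul, Matrix.mul_assoc]

theorem charpoly_generator (hp : IsProfile v β ρ) {δ : Fin 3 → ℝ} (hδ : IsFrequencyTriple β ρ δ)
    {lam : ℂ} (hlam : lam ≠ 0) :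
    (generator F lam).charpoly = ∏ j, (Polynomial.X - Polynomial.C (I * δ j)) := by
  have hunit := isUnit_diagonal_frameScale F hlam 0
  have hw : (v 0 : ℂ) ≠ 0 := ofReal_ne_zero.mpr (hp.pos 0).ne'
  have henergy : ((deriv v 0 : ℝ) : ℂ) ^ 2 / 4 + ρ ^ 2 + 2 * (v 0 : ℂ) ^ 3 = β * v 0 ^ 2 := by
    exact_mod_cast congrArg ofReal (hp.energy 0)
  rw [hF.generator_eq hv hρ lam, Matrix.charpoly_mul_comm, ← Matrix.mul_assoc,
    Matrix.mul_nonsing_inv _ ((Matrix.isUnit_iff_isUnit_det _).mp hunit), Matrix.one_mul,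
    charpoly_frameConnection hw henergy, hδ.prod_X_sub_C]

end IsMinimalLagrangianLift

end Generator

section PlaneLattices

/-- The real elements of a subgroup of `ℂ`. -/
def realElements (L : AddSubgroup ℂ) : AddSubgroup ℝ := L.comap ofRealHom.toAddMonoidHom

theorem mem_realElements {L : AddSubgroup ℂ} {x : ℝ} : x ∈ realElements L ↔ (x : ℂ) ∈ L := Iff.rfl

/-- The properties of the period lattice which leave only two possibilities for it once it contains
a nonzero real number. -/
structure IsStripLattice (L : AddSubgroup ℂ) (T : ℝ) : Prop where
  ne_zero : T ≠ 0
  exists_im_eq : ∀ τ ∈ L, ∃ m : ℤ, τ.im = m * (2 * T)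
  four_mem : 4 * (T : ℂ) * I ∈ L
  two_notMem : 2 * (T : ℂ) * I ∉ L
  exists_gap : ∃ a : ℝ, 0 < a ∧ Disjoint (realElements L : Set ℝ) (Set.Ioo 0 a)

theorem eq_zmultiples_sup {L : AddSubgroup ℂ} {p : ℝ}
    (hp : realElements L = AddSubgroup.zmultiples p) {g : ℂ} (hg : g ∈ L)
    (hn : ∀ τ ∈ L, ∃ n : ℤ, τ.im = n * g.im) :
    L = AddSubgroup.zmultiples (p : ℂ) ⊔ AddSubgroup.zmultiples g := by
  have hpL : (p : ℂ) ∈ L := mem_realElements.mp (hp ▸ AddSubgroup.mem_zmultiples p)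
  refine le_antisymm (fun τ hτ => ?_) (sup_le (AddSubgroup.zmultiples_le_of_mem hpL)
    (AddSubgroup.zmultiples_le_of_mem hg))
  obtain ⟨n, hn⟩ := hn τ hτ
  have hreal : (((τ - n • g).re : ℝ) : ℂ) = τ - n • g := Complex.ext (by simp) (by simp [hn])
  have hmem : (τ - n • g).re ∈ realElements L := by
    rw [mem_realElements, hreal]
    exact sub_mem hτ (zsmul_mem hg n)
  rw [hp, AddSubgroup.mem_zmultiples_iff] at hmem
  obtain ⟨k, hk⟩ := hmem
  refine AddSubgroup.mem_sup.mpr ⟨k • (p : ℂ), AddSubgroup.zsmul_mem_zmultiples _ k, n • g,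
    AddSubgroup.zsmul_mem_zmultiples _ n, ?_⟩
  have hkp : k • (p : ℂ) = τ - n • g := by rw [← hreal, ← hk, ofReal_zsmul]
  rw [hkp, sub_add_cancel]

namespace IsStripLattice

variable {L : AddSubgroup ℂ} {T : ℝ} (hL : IsStripLattice L T)
include hL

theorem exists_real_add_mem {τ : ℂ} (hτ : τ ∈ L) {n : ℤ} (hn : τ.im = (2 * n + 1 : ℤ) * (2 * T)) :
    ∃ x : ℝ, x + 2 * (T : ℂ) * I ∈ L := by
  have h : τ - n • (4 * (T : ℂ) * I) = τ.re + 2 * (T : ℂ) * I := by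
    refine Complex.ext (by simp) ?_
    push_cast at hn
    simp [hn]
    ring
  exact ⟨τ.re, h ▸ sub_mem hτ (zsmul_mem hL.four_mem n)⟩

theorem half_add_mem {p x : ℝ} (hp : realElements L = AddSubgroup.zmultiples p)
    (hx : x + 2 * (T : ℂ) * I ∈ L) : p / 2 + 2 * (T : ℂ) * I ∈ L := by
  have hpL : (p : ℂ) ∈ L := mem_realElements.mp (hp ▸ AddSubgroup.mem_zmultiples p)
  have hdouble : 2 * x ∈ realElements L := by
    have h := sub_mem (add_mem hx hx) hL.four_mem
    rw [mem_realElements]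
    convert h using 1
    push_cast
    ring
  rw [hp, AddSubgroup.mem_zmultiples_iff] at hdouble
  obtain ⟨k, hk⟩ := hdouble
  rw [zsmul_eq_mul] at hk
  have hk : (k : ℂ) * p = 2 * x := by exact_mod_cast congrArg ofReal hk
  obtain ⟨j, rfl | rfl⟩ := Int.even_or_odd' k
  · refine absurd ?_ hL.two_notMem
    convert sub_mem hx (zsmul_mem hpL j) using 1
    push_cast at hk
    rw [zsmul_eq_mul]
    linear_combination hk / 2
  · convert sub_mem hx (zsmul_mem hpL j) using 1
    push_cast at hk
    rw [zsmul_eq_mul]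
    linear_combination hk / 2

theorem eq_or_eq {p : ℝ} (hp : realElements L = AddSubgroup.zmultiples p) :
    L = AddSubgroup.zmultiples (p : ℂ) ⊔ AddSubgroup.zmultiples (4 * (T : ℂ) * I) ∨
      L = AddSubgroup.zmultiples (p : ℂ) ⊔
        AddSubgroup.zmultiples ((p : ℂ) / 2 + 2 * (T : ℂ) * I) := by
  by_cases heven : ∀ τ ∈ L, ∃ n : ℤ, τ.im = n * (4 * T)
  · exact .inl (eq_zmultiples_sup hp hL.four_mem (by simpa using heven))
  · push Not at heven
    obtain ⟨τ, hτ, hne⟩ := heven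
    obtain ⟨m, hm⟩ := hL.exists_im_eq τ hτ
    obtain ⟨n, rfl | rfl⟩ := Int.even_or_odd' m
    · exact absurd (by rw [hm]; push_cast; ring) (hne n)
    · obtain ⟨x, hx⟩ := hL.exists_real_add_mem hτ hm
      refine .inr (eq_zmultiples_sup hp (hL.half_add_mem hp hx) ?_)
      have him : ((p : ℂ) / 2 + 2 * (T : ℂ) * I).im = 2 * T := by simp
      simpa only [him] using hL.exists_im_eq

theorem exists_isLeast_and_eq_or_eq (hne : realElements L ≠ ⊥) :
    ∃ p : ℝ, IsLeast {t : ℝ | 0 < t ∧ (t : ℂ) ∈ L} p ∧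
      (L = AddSubgroup.zmultiples (p : ℂ) ⊔ AddSubgroup.zmultiples (4 * (T : ℂ) * I) ∨
        L = AddSubgroup.zmultiples (p : ℂ) ⊔
          AddSubgroup.zmultiples ((p : ℂ) / 2 + 2 * (T : ℂ) * I)) := by
  obtain ⟨a, ha, hgap⟩ := hL.exists_gap
  obtain ⟨p, hp⟩ := AddSubgroup.exists_isLeast_pos hne ha hgap
  refine ⟨p, ?_, hL.eq_or_eq ((AddSubgroup.cyclic_of_min hp).trans
    (AddSubgroup.zmultiples_eq_closure p).symm)⟩
  simpa only [mem_realElements, and_comm] using hp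

theorem re_eq_zero (hbot : realElements L = ⊥) {τ : ℂ} (hτ : τ ∈ L) : τ.re = 0 := by
  obtain ⟨m, hm⟩ := hL.exists_im_eq τ hτ
  have him : (τ.im : ℂ) = m * (2 * T) := mod_cast congrArg ofReal hm
  have hdouble : ((2 * τ.re : ℝ) : ℂ) = τ + τ - m • (4 * (T : ℂ) * I) := by
    push_cast [zsmul_eq_mul]
    linear_combination 2 * re_add_im τ - 2 * I * him
  have hmem : 2 * τ.re ∈ realElements L := by
    rw [mem_realElements, hdouble]
    exact sub_mem (add_mem hτ hτ) (zsmul_mem hL.four_mem m)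
  rw [hbot, AddSubgroup.mem_bot] at hmem
  linarith

theorem exists_linearIndependent_iff :
    (∃ w₁ ∈ L, ∃ w₂ ∈ L, LinearIndependent ℝ ![w₁, w₂]) ↔ realElements L ≠ ⊥ := by
  constructor
  · rintro ⟨w₁, h₁, w₂, h₂, hli⟩ hbot
    rw [LinearIndependent.pair_iff] at hli
    have hre₁ := hL.re_eq_zero hbot h₁
    have hre₂ := hL.re_eq_zero hbot h₂
    have him₁ : w₁.im = 0 := neg_eq_zero.mp (hli w₂.im (-w₁.im)
      (Complex.ext (by simp [hre₁, hre₂]) (by simp [mul_comm]))).2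
    exact one_ne_zero (hli 1 0 (Complex.ext (by simp [hre₁]) (by simp [him₁]))).1
  · intro hne
    obtain ⟨x, hx₀⟩ := AddSubgroup.ne_bot_iff_exists_ne_zero.mp hne
    have hx₀ : (x : ℝ) ≠ 0 := Subtype.coe_ne_coe.mpr hx₀
    refine ⟨(x : ℝ), mem_realElements.mp x.2, _, hL.four_mem, LinearIndependent.pair_iff.mpr ?_⟩
    intro s t hst
    have hre : s * x = 0 := by simpa using congrArg Complex.re hst
    have him : t * (4 * T) = 0 := by simpa using congrArg Complex.im hst
    exact ⟨(mul_eq_zero.mp hre).resolve_right hx₀,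
      (mul_eq_zero.mp him).resolve_right (mul_ne_zero four_ne_zero hL.ne_zero)⟩

end IsStripLattice

end PlaneLattices

section Phases

theorem exp_phase_eq_iff {a b x : ℝ} :
    cexp (I * a * x) = cexp (I * b * x) ↔ ∃ n : ℤ, (a - b) * x = n * (2 * Real.pi) := by
  rw [Complex.exp_eq_exp_iff_exists_int]
  refine exists_congr fun n => ⟨fun h => ?_, fun h => ?_⟩
  · refine ofReal_injective (mul_left_cancel₀ I_ne_zero ?_)
    push_cast
    linear_combination h
  · have h' : ((a - b) * x : ℂ) = n * (2 * Real.pi) := by exact_mod_cast congrArg ofReal h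
    linear_combination I * h'

theorem exists_forall_Ioo_exp_phase_ne {a b : ℝ} (hab : a ≠ b) :
    ∃ r : ℝ, 0 < r ∧ ∀ x ∈ Set.Ioo 0 r, cexp (I * a * x) ≠ cexp (I * b * x) := by
  have hpos : 0 < |a - b| := abs_pos.mpr (sub_ne_zero.mpr hab)
  refine ⟨2 * Real.pi / |a - b|, by positivity, fun x ⟨hx₀, hx⟩ heq => ?_⟩
  obtain ⟨n, hn⟩ := exp_phase_eq_iff.mp heq
  have habs : |a - b| * x = |(n : ℝ)| * (2 * Real.pi) := by
    rw [← abs_of_pos hx₀, ← abs_mul, hn, abs_mul, abs_of_pos Real.two_pi_pos]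
  rw [lt_div_iff₀ hpos, mul_comm, habs, mul_lt_iff_lt_one_left Real.two_pi_pos] at hx
  have hn₀ : n = 0 := Int.abs_lt_one_iff.mp (by exact_mod_cast hx)
  rw [hn₀, Int.cast_zero, abs_zero, zero_mul] at habs
  exact (mul_pos hpos hx₀).ne' habs

theorem exists_rat_of_phases_eq {δ : Fin 3 → ℝ} (hsum : δ 0 + δ 1 + δ 2 = 0) (h₁ : δ 1 ≠ 0) {x : ℝ}
    (hx : x ≠ 0) {c : ℂ} (hc : ∀ j, cexp (I * δ j * x) = c) : ∃ q : ℚ, δ 0 / δ 1 = q := by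
  obtain ⟨n, hn⟩ := exp_phase_eq_iff.mp ((hc 0).trans (hc 1).symm)
  obtain ⟨l, hl⟩ := exp_phase_eq_iff.mp ((hc 0).trans (hc 2).symm)
  have hx₀ : 3 * (x * δ 0) = 2 * Real.pi * (n + l) := by linear_combination hn + hl + x * hsum
  have hx₁ : 3 * (x * δ 1) = 2 * Real.pi * (l - 2 * n) := by
    linear_combination hl - 2 * hn + x * hsum
  have hne : (l - 2 * n : ℝ) ≠ 0 := fun h => by
    rw [h, mul_zero] at hx₁
    exact mul_ne_zero three_ne_zero (mul_ne_zero hx h₁) hx₁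
  refine ⟨(n + l : ℤ) / (l - 2 * n : ℤ), ?_⟩
  push_cast
  rw [div_eq_div_iff h₁ hne]
  refine mul_left_cancel₀ Real.two_pi_pos.ne' ?_
  linear_combination δ 1 * hx₀ - δ 0 * hx₁

theorem exists_phases_eq_of_rat {δ : Fin 3 → ℝ} (hsum : δ 0 + δ 1 + δ 2 = 0) (h₁ : δ 1 ≠ 0) {q : ℚ}
    (hq : δ 0 / δ 1 = q) : ∃ x : ℝ, x ≠ 0 ∧ ∃ c : ℂ, ∀ j, cexp (I * δ j * x) = c := by
  have h₀ : δ 0 = q * δ 1 := by rw [← hq, div_mul_cancel₀ _ h₁]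
  have h₂ : δ 2 = -(q * δ 1 + δ 1) := by linear_combination hsum - h₀
  have hden : (q.den : ℝ) ≠ 0 := Nat.cast_ne_zero.mpr q.den_nz
  have hnum : (q.num : ℝ) = q * q.den := by exact_mod_cast q.mul_den_eq_num.symm
  refine ⟨2 * Real.pi * q.den / δ 1, div_ne_zero (mul_ne_zero Real.two_pi_pos.ne' hden) h₁, 1, ?_⟩
  have key {a : ℝ} {m : ℤ} (ha : a * q.den = m * δ 1) :
      cexp (I * a * (2 * Real.pi * q.den / δ 1 : ℝ)) = 1 := by
    have h := (exp_phase_eq_iff (a := a) (b := 0) (x := 2 * Real.pi * q.den / δ 1)).mpr ⟨m, by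
      field_simp
      linear_combination ha⟩
    simpa using h
  intro j
  fin_cases j
  · exact key (m := q.num) (by rw [hnum, Fin.zero_eta, h₀]; ring)
  · exact key (m := q.den) (by simp [mul_comm])
  · refine key (a := δ 2) (m := -(q.num + q.den)) ?_
    push_cast
    rw [hnum, h₂]
    ring

end Phases

section Eigenvalues

open Polynomial

theorem exists_perm_of_prod_X_sub_C_eq {ι R : Type*} [Fintype ι] [CommRing R] [IsDomain R]
    {a b : ι → R} (hb : Function.Injective b) (h : ∏ i, (X - C (a i)) = ∏ i, (X - C (b i))) :
    ∃ σ : Equiv.Perm ι, a = b ∘ σ := by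
  have hroots (c : ι → R) : (∏ i, (X - C (c i))).roots = Finset.univ.val.map c := by
    rw [← roots_multiset_prod_X_sub_C (Finset.univ.val.map c), Multiset.map_map]
    rfl
  have hmap : Finset.univ.val.map a = Finset.univ.val.map b := by rw [← hroots, h, hroots]
  have ha : Function.Injective a := fun i j => Multiset.inj_on_of_nodup_map
    (hmap ▸ Finset.univ.nodup.map hb) i (Finset.mem_univ_val i) j (Finset.mem_univ_val j)
  have hmem (i : ι) : ∃ j, b j = a i := by
    have hi : a i ∈ Finset.univ.val.map b :=
      hmap ▸ Multiset.mem_map_of_mem a (Finset.mem_univ_val i)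
    simpa using hi
  choose σ hσ using hmem
  have hinj : Function.Injective σ := fun i j hij => ha (by rw [← hσ, ← hσ, hij])
  exact ⟨Equiv.ofBijective σ hinj.bijective_of_finite, funext fun i => (hσ i).symm⟩

theorem exists_perm_of_prod_X_sub_C_I_mul_eq {ι : Type*} [Fintype ι] {d : ι → ℂ} {δ : ι → ℝ}
    (hδ : Function.Injective δ)
    (h : ∏ j, (X - C (I * d j)) = ∏ j, (X - C (I * (δ j : ℂ)))) :
    ∃ σ : Equiv.Perm ι, ∀ j, d j = δ (σ j) := by
  obtain ⟨σ, hσ⟩ := exists_perm_of_prod_X_sub_C_eq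
    ((mul_right_injective₀ I_ne_zero).comp (ofReal_injective.comp hδ)) h
  exact ⟨σ, fun j => mul_left_cancel₀ I_ne_zero (congrFun hσ j)⟩

end Eigenvalues

theorem IsFrequencyTriple.ne_zero {β ρ : ℝ} {δ : Fin 3 → ℝ} (hδ : IsFrequencyTriple β ρ δ)
    (hρ : ρ ≠ 0) (j : Fin 3) : δ j ≠ 0 := by
  have hprod : ∏ j, δ j ≠ 0 := by
    rw [Fin.prod_univ_three, hδ.prod_eq]
    exact neg_ne_zero.mpr (mul_ne_zero two_ne_zero hρ)
  exact Finset.prod_ne_zero_iff.mp hprod j (Finset.mem_univ j)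

section PhasePeriods

variable {L : AddSubgroup ℂ} {δ : Fin 3 → ℝ} {T : ℝ} (hT : T ≠ 0)
  (hL : ∀ τ, τ ∈ L ↔ IsPhasePeriod δ T τ)
include hT hL

theorem mem_realElements_iff_exists_phases_eq {x : ℝ} :
    x ∈ realElements L ↔ ∃ c : ℂ, ∀ j, cexp (I * δ j * x) = c := by
  rw [mem_realElements, hL, IsPhasePeriod]
  constructor
  · rintro ⟨m, hm, hc⟩
    have hm₀ : m = 0 := by
      simpa only [ofReal_im, zero_eq_mul, mul_eq_zero, Int.cast_eq_zero, hT, two_ne_zero,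
        or_false] using hm
    simpa only [hm₀, zpow_zero, mul_one, ofReal_re] using hc
  · exact fun hc => ⟨0, by simp, by simpa only [zpow_zero, mul_one, ofReal_re] using hc⟩

theorem isStripLattice_of_isPhasePeriod (hδ : δ 0 ≠ δ 1) : IsStripLattice L T where
  ne_zero := hT
  exists_im_eq τ hτ := ((hL τ).mp hτ).imp fun _ h => h.1
  four_mem := by
    have him : (4 * T * I : ℂ).im = (2 : ℤ) * (2 * T) := by
      rw [← ofReal_ofNat, ← ofReal_mul, mul_I_im, ofReal_re, Int.cast_ofNat]
      ring
    refine (hL _).mpr ⟨2, him, 1, fun j => ?_⟩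
    fin_cases j <;> simp [translationSign]
  two_notMem h := by
    obtain ⟨m, hm, c, hc⟩ := (hL _).mp h
    have hm₁ : m = 1 := by
      have him : (m : ℝ) * (2 * T) = 1 * (2 * T) := by rw [← hm]; simp
      exact_mod_cast mul_right_cancel₀ (mul_ne_zero two_ne_zero hT) him
    have hsign := (hc 0).trans (hc 2).symm
    rw [hm₁] at hsign
    exact neg_ne_self.mpr one_ne_zero (by simpa [translationSign] using hsign)
  exists_gap := by
    obtain ⟨a, ha, hgap⟩ := exists_forall_Ioo_exp_phase_ne hδ
    refine ⟨a, ha, Set.disjoint_left.mpr fun x hx hxa => hgap x hxa ?_⟩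
    obtain ⟨c, hc⟩ := (mem_realElements_iff_exists_phases_eq hT hL).mp hx
    exact (hc 0).trans (hc 1).symm

theorem realElements_ne_bot_iff (hsum : δ 0 + δ 1 + δ 2 = 0) (σ : Equiv.Perm (Fin 3))
    (h₁ : δ (σ 1) ≠ 0) :
    realElements L ≠ ⊥ ↔ ∃ q : ℚ, (δ (σ 0) : ℂ) / δ (σ 1) = q := by
  have hsum' : δ (σ 0) + δ (σ 1) + δ (σ 2) = 0 := by
    rw [← hsum, ← Fin.sum_univ_three, ← Fin.sum_univ_three (fun j => δ (σ j))]
    exact Equiv.sum_comp σ δ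
  have hphases (x : ℝ) :
      x ∈ realElements L ↔ ∃ c : ℂ, ∀ j, cexp (I * δ (σ j) * x) = c :=
    (mem_realElements_iff_exists_phases_eq hT hL).trans
      (exists_congr fun c => (σ.forall_congr_right (q := fun j => cexp (I * δ j * x) = c)).symm)
  constructor
  · intro hne
    obtain ⟨⟨x, hx⟩, hx₀⟩ := AddSubgroup.ne_bot_iff_exists_ne_zero.mp hne
    obtain ⟨c, hc⟩ := (hphases x).mp hx
    obtain ⟨q, hq⟩ :=
      exists_rat_of_phases_eq (δ := δ ∘ σ) hsum' h₁ (fun h => hx₀ (Subtype.ext h)) hc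
    exact ⟨q, by exact_mod_cast congrArg ofReal hq⟩
  · rintro ⟨q, hq⟩
    obtain ⟨x, hx₀, hx⟩ :=
      exists_phases_eq_of_rat (δ := δ ∘ σ) hsum' h₁ (by exact_mod_cast hq)
    exact AddSubgroup.ne_bot_iff_exists_ne_zero.mpr
      ⟨⟨x, (hphases x).mpr hx⟩, fun h => hx₀ (congrArg Subtype.val h)⟩

end PhasePeriods

end

end MinLag

open MinLag Complex Polynomial in
theorem mainTheorem9_general
    (f : ℂ → CP2) (F : ℂ → C3)
    (hF : IsMinimalLagrangianLift F f)
    (hmetric : ∀ z (t : ℝ), metricU F (z + t) = metricU F z)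
    (hnonflat : ∃ z w, metricU F z ≠ metricU F w)
    (lam : ℂ) (hlam : lam ≠ 0)
    (ψ : ℂ → ℂ) (hψ : ∀ z, hopf F z = -I * lam ^ (-3 : ℤ) * ψ z)
    (hψ_ne : ∃ z, ψ z ≠ 0)
    (hreal : ∀ z, (lam ^ (-3 : ℤ) * ψ z).im = 0)
    (d₁ d₂ d₃ : ℂ)
    (hd : (generator F lam).charpoly = (X - C (I * d₁)) * (X - C (I * d₂)) * (X - C (I * d₃))) :
    (IsEquivariantTorus f →
      (∃ p : ℝ, IsLeast {t : ℝ | 0 < t ∧ (t : ℂ) ∈ periodLattice f} p ∧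
        (periodLattice f = AddSubgroup.zmultiples (p : ℂ) ⊔
            AddSubgroup.zmultiples (4 * (halfPeriod F : ℂ) * I) ∨
          periodLattice f = AddSubgroup.zmultiples (p : ℂ) ⊔
            AddSubgroup.zmultiples ((p : ℂ) / 2 + 2 * (halfPeriod F : ℂ) * I))) ∧
      d₂ ≠ 0 ∧ ∃ q : ℚ, d₁ / d₂ = (q : ℂ)) ∧
    ((∃ q : ℚ, d₁ / d₂ = (q : ℂ)) →
      IsEquivariantTorus f ∧
      ∃ p : ℝ, IsLeast {t : ℝ | 0 < t ∧ (t : ℂ) ∈ periodLattice f} p ∧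
        (periodLattice f = AddSubgroup.zmultiples (p : ℂ) ⊔
            AddSubgroup.zmultiples (4 * (halfPeriod F : ℂ) * I) ∨
          periodLattice f = AddSubgroup.zmultiples (p : ℂ) ⊔
            AddSubgroup.zmultiples ((p : ℂ) / 2 + 2 * (halfPeriod F : ℂ) * I))) := by
  obtain ⟨v, hv⟩ : ∃ v : ℝ → ℝ, ∀ z, expU F z = v z.im :=
    ⟨fun y => expU F (y * I), hF.expU_eq_expU_im hmetric⟩
  obtain ⟨ρ, hhopf⟩ := hF.exists_hopf_eq fun z => by simpa [hψ, mul_assoc] using hreal z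
  have hρ : ρ ≠ 0 := by
    rintro rfl
    obtain ⟨z, hz⟩ := hψ_ne
    have hzero := (hψ z).symm.trans (hhopf z)
    simp [hlam, hz] at hzero
  obtain ⟨β, hp⟩ := hF.exists_isProfile hv hhopf
  obtain ⟨δ, hδ, hT, hperiod⟩ := hF.exists_frequencies hv hhopf hp hρ hnonflat
  have hL := isStripLattice_of_isPhasePeriod hT hperiod (hδ.injective.ne (by decide))
  obtain ⟨σ, hσ⟩ := exists_perm_of_prod_X_sub_C_I_mul_eq (d := ![d₁, d₂, d₃]) hδ.injective <| by
    rw [← hF.charpoly_generator hv hhopf hp hδ hlam, hd, Fin.prod_univ_three]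
    rfl
  obtain rfl : d₁ = δ (σ 0) := hσ 0
  obtain rfl : d₂ = δ (σ 1) := hσ 1
  have hd₂ := hδ.ne_zero hρ (σ 1)
  have hrat : IsEquivariantTorus f ↔ ∃ q : ℚ, (δ (σ 0) : ℂ) / δ (σ 1) = q :=
    hL.exists_linearIndependent_iff.trans (realElements_ne_bot_iff hT hperiod hδ.sum_eq σ hd₂)
  have hlattice (hf : IsEquivariantTorus f) :=
    hL.exists_isLeast_and_eq_or_eq (hL.exists_linearIndependent_iff.mp hf)
  exact ⟨fun hf => ⟨hlattice hf, ofReal_ne_zero.mpr hd₂, hrat.mp hf⟩,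
    fun hq => ⟨hrat.mpr hq, hlattice (hrat.mpr hq)⟩⟩

open MinLag Complex Polynomial in
theorem mainTheorem9
    (f : ℂ → CP2) (F : ℂ → C3)
    (hF : IsMinimalLagrangianLift F f)
    (hequiv : IsTranslationallyEquivariant f)
    (hnonflat : ∃ z w, metricU F z ≠ metricU F w)
    (lam : ℂ) (hlam : ‖lam‖ = 1)
    (ψ : ℂ → ℂ) (hψ : ∀ z, hopf F z = -I * lam ^ (-3 : ℤ) * ψ z)
    (hψ_ne : ∃ z, ψ z ≠ 0)
    (hreal : ∀ z, (lam ^ (-3 : ℤ) * ψ z).im = 0)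
    (d₁ d₂ d₃ : ℂ)
    (hd : (generator F lam).charpoly = (X - C (I * d₁)) * (X - C (I * d₂)) * (X - C (I * d₃))) :
    (IsEquivariantTorus f →
      (∃ p : ℝ, IsLeast {t : ℝ | 0 < t ∧ (t : ℂ) ∈ periodLattice f} p ∧
        (periodLattice f = AddSubgroup.zmultiples (p : ℂ) ⊔
            AddSubgroup.zmultiples (4 * (halfPeriod F : ℂ) * I) ∨
          periodLattice f = AddSubgroup.zmultiples (p : ℂ) ⊔
            AddSubgroup.zmultiples ((p : ℂ) / 2 + 2 * (halfPeriod F : ℂ) * I))) ∧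
      d₂ ≠ 0 ∧ ∃ q : ℚ, d₁ / d₂ = (q : ℂ)) ∧
    ((∃ q : ℚ, d₁ / d₂ = (q : ℂ)) →
      IsEquivariantTorus f ∧
      ∃ p : ℝ, IsLeast {t : ℝ | 0 < t ∧ (t : ℂ) ∈ periodLattice f} p ∧
        (periodLattice f = AddSubgroup.zmultiples (p : ℂ) ⊔
            AddSubgroup.zmultiples (4 * (halfPeriod F : ℂ) * I) ∨
          periodLattice f = AddSubgroup.zmultiples (p : ℂ) ⊔
            AddSubgroup.zmultiples ((p : ℂ) / 2 + 2 * (halfPeriod F : ℂ) * I))) :=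
  mainTheorem9_general f F hF (hF.metricU_add_ofReal hequiv) hnonflat lam
    (norm_ne_zero_iff.mp (hlam ▸ one_ne_zero)) ψ hψ hψ_ne hreal d₁ d₂ d₃ hd
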